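/- **Setting.** Let $X$ be a metrizable suborderable space with infinitely many connected components. Fix a compatible linear order $\le$ on $X$, i.e. a linear order whose open interval topology is coarser than the topology of $X$ and such that $X$ has a base of $\le$-convex open sets. Fix also a metric $\rho$ that induces the topology of $X$ and is convex: $\rho(a,b)\le\rho(x,y)$ whenever $x\le a\le b\le y$. Diameters are taken with respect to $\rho$ and may be $\infty$. For $A,B\subset X$ write $A<B$ if $x<y$ for all $x\in A$, $y\in B$, and put $(\leftarrow,A)=\{x: x<y \text{ for all } y\in A\}$, $(A,\to)=\{x: y<x\text{ for all }y\in A\}$, $(\leftarrow,A]=X\setminus(A,\to)$, $[A,\to)=X\setminus(\leftarrow,A)$. Let $\mathscr C[X]$ be the set of components of $X$. For $C\in\mathscr C[X]$ put $\ell(C)=|\overline{(\leftarrow,C)}\cap C|$ and $r(C)=|C\cap\overline{(C,\to)}|$ (both are $0$ or $1$). For $\varepsilon>0$ let $\mathbf O(C,\varepsilon)=\bigcup_{x\in C}\{y:\rho(x,y)<\varepsilon\}$, and let $\Delta(C,\varepsilon)$ be $C$ if $\ell(C)=r(C)=0$; $\mathbf O(C,\frac\varepsilon2)\cap(\leftarrow,C]$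 if $\ell(C)\ne0=r(C)$; $\mathbf O(C,\frac\varepsilon2)\cap[C,\to)$ if $\ell(C)=0\ne r(C)$; and $\mathbf O(C,\frac\varepsilon2)$ if $\ell(C)\neq0\neq r(C)$. For a clopen set $U$ let $\mathscr C[U]$ be the set of components of $X$ that meet $U$, and let $\mathscr C_\varepsilon[U]=\{C\in\mathscr C[U]:\operatorname{diam}(C)\ge\varepsilon\}$. Let $\mathscr D[X]$ be the collection of all clopen $U\subset X$ such that $U\in\mathscr C[X]$ or $\mathscr C[U]$ is infinite, and let $\mathscr D[X,\varepsilon]$ be the collection of all $U\in\mathscr D[X]$ such that $\operatorname{diam}(U)<\varepsilon$, or $U\subset\Delta(C,\varepsilon)$ for some $C\in\mathscr C_\varepsilon[U]$. A component $C$ is non-degenerate if $\operatorname{diam}(C)>0$; then $\kappa[C]=\min\{n<\omega:\operatorname{diam}(C)\ge2^{-n}\}$. A tree is a partially ordered set $(T,\preceq)$ in which every set $\{s: s\preceq t\}$ is well ordered. Its levels $T(\alpha)$ are defined recursively: $T(\alpha)$ is the set of minimal elements of $T\setminus\bigcup_{\beta<\alpha}T(\beta)$. The tree is $\omega$-levelled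 if its height (the least $\alpha$ with $T=\bigcup_{\beta<\alpha}T(\beta)$) is $\omega$. Write $\operatorname{node}(t)$ for the set of immediate successors of $t$. The tree is pruned if $\operatorname{node}(t)\neq\emptyset$ for every $t$, and anti-binary if $|T(0)|\ne2$ and $|\operatorname{node}(t)|\neq2$ for every $t$. A branch is a maximal linearly ordered subset. A sieve on $X$ is a map $\mathscr S$ from $T$ to the nonempty subsets of $X$ with $X=\bigcup_{t\in T(0)}\mathscr S(t)$ and $\mathscr S(t)=\bigcup_{s\in\operatorname{node}(t)}\mathscr S(s)$ for all $t$. It is discrete if for every $n<\omega$ the indexed family $\{\mathscr S(t):t\in T(n)\}$ is a discrete cover of $X$ (every point has a neighbourhood meeting $\mathscr S(t)$ for at most one $t\in T(n)$). **Theorem.** There exist an anti-binary pruned $\omega$-levelled tree $T$ and a discrete sieve $\mathscr S:T\to\mathscr D[X]$ on $X$ such that $\mathscr S(t)\in\mathscr D[X,2^{-n}]$ for every $n<\omega$ and $t\in T(n)$. Moreover, for every non-degenerate component $C$ of $X$ there is exactly one branch $\beta$ of $T$ with $C\subset\bigcap_{t\in\beta}\mathscr S(t)$, and for this $\beta$,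 all $n\ge\kappa[C]$, $t\in\beta\cap T(n)$ and $p\in\beta\cap\operatorname{node}(t)$: 1. for every $s\in\operatorname{node}(t)$ with $s\ne p$, $\operatorname{diam}(\mathscr S(s))\le2^{-n+1}$, and $\mathscr S(s)<C$ or $C<\mathscr S(s)$; 2. $|\{s\in\operatorname{node}(t):\mathscr S(s)<C\}|\ge6\,\ell(C)$ and $|\{s\in\operatorname{node}(t):C<\mathscr S(s)\}|\ge6\,r(C)$. -/

import Mathlib

open Set Topology
open scoped ENNReal

universe u

namespace SuborderSieve

/-! ### Suborderable spaces and convex metrics -/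

/-- The linear order of `X` is compatible with the topology of `X` (that is, `(X, ≤)` is
suborderable): the open interval topology is coarser than the topology of `X`, and `X` has a base
of convex open sets. -/
def IsSuborderable (X : Type u) [t : TopologicalSpace X] [LinearOrder X] : Prop :=
  t ≤ Preorder.topology X ∧
    ∃ B : Set (Set X), TopologicalSpace.IsTopologicalBasis B ∧ ∀ U ∈ B, U.OrdConnected

/-- The metric of `X` is convex with respect to the linear order of `X`. -/
def IsConvexMetric (X : Type u) [MetricSpace X] [LinearOrder X] : Prop :=
  ∀ x a b y : X, x ≤ a → a ≤ b → b ≤ y → dist a b ≤ dist x y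

/-! ### Components -/

/-- The set of all connected components of `X`. -/
def components (X : Type u) [TopologicalSpace X] : Set (Set X) :=
  Set.range fun x : X => connectedComponent x

/-- For a clopen set `U`, the set of all components of `X` which meet `U` (equivalently, which are
contained in `U`). -/
def componentsIn {X : Type u} [TopologicalSpace X] (U : Set X) : Set (Set X) :=
  {C | C ∈ components X ∧ (C ∩ U).Nonempty}

section Order

variable {X : Type u} [LinearOrder X]

/-- `A < B` for subsets of an ordered set. -/
def SetLT (A B : Set X) : Prop := ∀ x ∈ A, ∀ y ∈ B, x < y

/-- The open interval `(←, A)`. -/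
def openLeft (A : Set X) : Set X := {x | ∀ y ∈ A, x < y}

/-- The open interval `(A, →)`. -/
def openRight (A : Set X) : Set X := {x | ∀ y ∈ A, y < x}

/-- The closed interval `(←, A]`, the complement of `(A, →)`. -/
def closedLeft (A : Set X) : Set X := (openRight A)ᶜ

/-- The closed interval `[A, →)`, the complement of `(←, A)`. -/
def closedRight (A : Set X) : Set X := (openLeft A)ᶜ

variable [TopologicalSpace X]

/-- The number `ℓ(C)` of points of `C` in the closure of `(←, C)`. -/
noncomputable def ell (C : Set X) : ℕ := (closure (openLeft C) ∩ C).ncard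

/-- The number `r(C)` of points of `C` in the closure of `(C, →)`. -/
noncomputable def arr (C : Set X) : ℕ := (C ∩ closure (openRight C)).ncard

end Order

/-- The open `ε`-neighbourhood `O(A, ε)` of a set `A`. -/
def openNhd {X : Type u} [MetricSpace X] (A : Set X) (ε : ℝ) : Set X :=
  ⋃ x ∈ A, Metric.ball x ε

/-- The one-sided or two-sided neighbourhood `Δ(C, ε)` of a component `C`. -/
noncomputable def Delta {X : Type u} [MetricSpace X] [LinearOrder X] (C : Set X) (ε : ℝ) : Set X :=
  if ell C = 0 ∧ arr C = 0 then C
  else if ell C ≠ 0 ∧ arr C = 0 then openNhd C (ε / 2) ∩ closedLeft C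
  else if ell C = 0 ∧ arr C ≠ 0 then openNhd C (ε / 2) ∩ closedRight C
  else openNhd C (ε / 2)

/-- The family `𝒟[X]` of all clopen sets which are a component of `X`, or contain infinitely many
components of `X`. -/
def clopenFamily (X : Type u) [TopologicalSpace X] : Set (Set X) :=
  {U | IsClopen U ∧ (U ∈ components X ∨ (componentsIn U).Infinite)}

/-- The components of `U` of diameter at least `ε`. The diameter takes the value `∞` on unbounded
sets. -/
def largeComponents {X : Type u} [MetricSpace X] (ε : ℝ) (U : Set X) : Set (Set X) :=
  {C | C ∈ componentsIn U ∧ ENNReal.ofReal ε ≤ Metric.ediam C}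

/-- The non-degenerate components of `U`. -/
def nondegenerateComponents {X : Type u} [MetricSpace X] (U : Set X) : Set (Set X) :=
  ⋃ (ε : ℝ) (_ : 0 < ε), largeComponents ε U

/-- The family `𝒟[X, ε]`. -/
def clopenFamilyWithin (X : Type u) [MetricSpace X] [LinearOrder X] (ε : ℝ) : Set (Set X) :=
  {U | U ∈ clopenFamily X ∧
    (Metric.ediam U < ENNReal.ofReal ε ∨ ∃ C ∈ largeComponents ε U, U ⊆ Delta C ε)}

/-- The least `n` such that the diameter of `C` is at least `2 ^ (-n)`. -/
noncomputable def kappa {X : Type u} [MetricSpace X] (C : Set X) : ℕ :=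
  sInf {n : ℕ | ENNReal.ofReal ((2 : ℝ) ^ (-(n : ℤ))) ≤ Metric.ediam C}

/-! ### Trees -/

/-- A partially ordered set is a tree if all sets `{s | s ≤ t}` are well ordered. -/
def IsTree (T : Type u) [PartialOrder T] : Prop :=
  ∀ t : T, IsWellOrder {s : T // s ≤ t} (· < ·)

/-- The `α`-th level of a tree: the minimal elements of the complement of all previous levels. -/
noncomputable def treeLevel (T : Type u) [PartialOrder T] (α : Ordinal.{u}) : Set T :=
  {t | Minimal (fun s : T => ∀ β, β < α → s ∉ treeLevel T β) t}
termination_by α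

/-- The height of a tree: the least ordinal `α` such that all elements have level below `α`. -/
noncomputable def treeHeight (T : Type u) [PartialOrder T] : Ordinal.{u} :=
  sInf {α | ∀ t : T, ∃ β, β < α ∧ t ∈ treeLevel T β}

/-- The node of `t`: the set of all immediate successors of `t`. -/
def node {T : Type u} [PartialOrder T] (t : T) : Set T := {s | t ⋖ s}

/-- A tree is pruned if all its nodes are nonempty. -/
def IsPruned (T : Type u) [PartialOrder T] : Prop := ∀ t : T, (node t).Nonempty

/-- A tree is anti-binary if neither its level `0` nor any node has exactly two elements. -/
def IsAntiBinary (T : Type u) [PartialOrder T] : Prop :=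
  (treeLevel T 0).encard ≠ 2 ∧ ∀ t : T, (node t).encard ≠ 2

/-- A branch is a maximal linearly ordered subset. -/
def IsBranch {T : Type u} [PartialOrder T] (b : Set T) : Prop := IsMaxChain (· ≤ ·) b

/-! ### Sieves -/

/-- A sieve on `X` indexed by a tree `T`: a map to the nonempty subsets of `X` such that the sets
on level `0` cover `X` and every set is the union of the sets on its node. -/
def IsSieve {T X : Type u} [PartialOrder T] (S : T → Set X) : Prop :=
  (∀ t, (S t).Nonempty) ∧ (⋃ t ∈ treeLevel T 0, S t) = univ ∧ ∀ t, S t = ⋃ s ∈ node t, S s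

/-- The indexed family `S t`, `t ∈ I`, is discrete: every point has a neighbourhood which meets
`S t` for at most one index `t ∈ I`. -/
def IsDiscreteOn {T X : Type u} [TopologicalSpace X] (S : T → Set X) (I : Set T) : Prop :=
  ∀ x : X, ∃ V ∈ 𝓝 x, {t | t ∈ I ∧ (S t ∩ V).Nonempty}.Subsingleton

/-- A sieve is discrete if on every level `T(n)`, `n < ω`, it is a discrete cover of `X`. -/
def IsDiscreteSieve {T X : Type u} [PartialOrder T] [TopologicalSpace X] (S : T → Set X) : Prop :=
  IsSieve S ∧ ∀ n : ℕ, IsDiscreteOn S (treeLevel T n) ∧ (⋃ t ∈ treeLevel T n, S t) = univ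

end SuborderSieve

open SuborderSieve

/-! The core is that every clopen set has a partition into members of 𝒟[X, ε]
(`exists_isFinePartition`). Points of different components are separated by clopen initial segments,
so components have small clopen neighbourhoods, which yield members of 𝒟[X, ε]
(`exists_mem_clopenFamilyWithin`). Such members are divisible: all their clopen subsets have fine
partitions, because by convexity the part of O(C, ε/2) on one side of C has diameter at most ε/2.
Divisibility passes to countable unions of clopen sets, and each ball of radius ε/4 lies in a
divisible clopen set. The points reached from a given one by steps shorter than ε/4 form a clopen
class, and convexity covers it by countably many such balls. These classes partition X.

A member U of 𝒟[X, η] has at most one component C of diameter at least η. If C exists and U ≠ C,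
then U ⊆ Δ(C, η) forces C to be a limit of at least one of its sides. Six components are reserved on
each such side, C is enclosed in a member of 𝒟[X, ε] avoiding them, and the two remainders are
partitioned finely enough (`exists_isSplitting`). Iteration with η = 2⁻ⁿ and ε = 2⁻ⁿ⁻¹ gives the
levels of the tree; the branch of C consists of all its elements whose sets contain C. -/

namespace SuborderSieve

/-! ### Clopen initial segments -/

section Suborderable

variable {X : Type u} [TopologicalSpace X] [LinearOrder X]

theorem IsSuborderable.isOpen_Iio (hX : IsSuborderable X) (a : X) : IsOpen (Iio a) :=
  hX.1 _ (TopologicalSpace.isOpen_generateFrom_of_mem ⟨a, Or.inr rfl⟩)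

theorem IsSuborderable.isOpen_Ioi (hX : IsSuborderable X) (a : X) : IsOpen (Ioi a) :=
  hX.1 _ (TopologicalSpace.isOpen_generateFrom_of_mem ⟨a, Or.inl rfl⟩)

theorem IsSuborderable.isClosed_Ici (hX : IsSuborderable X) (a : X) : IsClosed (Ici a) := by
  rw [← compl_Iio]; exact (hX.isOpen_Iio a).isClosed_compl

theorem IsSuborderable.isClosed_Iic (hX : IsSuborderable X) (a : X) : IsClosed (Iic a) := by
  rw [← compl_Ioi]; exact (hX.isOpen_Ioi a).isClosed_compl

theorem IsSuborderable.exists_ordConnected_nhd (hX : IsSuborderable X) {x : X} {V : Set X}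
    (hV : IsOpen V) (hx : x ∈ V) : ∃ W, IsOpen W ∧ x ∈ W ∧ W ⊆ V ∧ W.OrdConnected := by
  obtain ⟨B, hB, hc⟩ := hX.2
  obtain ⟨W, hW, hxW, hWV⟩ := hB.exists_subset_of_mem_open hx hV
  exact ⟨W, hB.isOpen hW, hxW, hWV, hc W hW⟩

theorem IsSuborderable.dual (hX : IsSuborderable X) : IsSuborderable Xᵒᵈ := by
  obtain ⟨B, hB, hc⟩ := hX.2
  refine ⟨?_, B, hB, fun U hU => (hc U hU).dual⟩
  refine le_generateFrom ?_
  rintro s ⟨a, rfl | rfl⟩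
  · exact hX.isOpen_Iio (OrderDual.ofDual a)
  · exact hX.isOpen_Ioi (OrderDual.ofDual a)

theorem IsSuborderable.ordConnected_of_isPreconnected (hX : IsSuborderable X) {C : Set X}
    (hC : IsPreconnected C) : C.OrdConnected := by
  refine ⟨fun a ha b hb c hc => ?_⟩
  by_contra hcC
  obtain ⟨z, -, h1, h2⟩ := hC (Iio c) (Ioi c) (hX.isOpen_Iio c) (hX.isOpen_Ioi c)
    (fun y hy => lt_or_gt_of_ne (fun h => hcC (h ▸ hy)))
    ⟨a, ha, lt_of_le_of_ne hc.1 (fun h => hcC (h ▸ ha))⟩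
    ⟨b, hb, lt_of_le_of_ne hc.2 (fun h => hcC (h ▸ hb))⟩
  exact lt_asymm (show z < c from h1) h2

/-- A separation of the interval `[x, a]` yields a clopen initial segment between `x` and `a`. -/
theorem IsSuborderable.exists_isClopen_isLowerSet_of_separation (hX : IsSuborderable X) {x a : X}
    {u v : Set X} (hu : IsOpen u) (hv : IsOpen v) (huv : Icc x a ⊆ u ∪ v)
    (hd : ¬ (Icc x a ∩ (u ∩ v)).Nonempty) (hxu : x ∈ u) (hav : (Icc x a ∩ v).Nonempty) :
    ∃ L : Set X, IsClopen L ∧ IsLowerSet L ∧ x ∈ L ∧ a ∉ L := by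
  obtain ⟨y, ⟨hxy, hya⟩, hyv⟩ := hav
  have hyu : y ∉ u := fun h => hd ⟨y, ⟨hxy, hya⟩, h, hyv⟩
  -- For `z < x` the interval is empty, so this set contains everything to the left of `x`.
  refine ⟨{z | Icc x z ⊆ u}, ⟨⟨?_⟩, ?_⟩, fun z w hwz hz c hc => hz ⟨hc.1, hc.2.trans hwz⟩,
    ?_, fun h => hyu (h ⟨hxy, hya⟩)⟩
  · rw [isOpen_iff_forall_mem_open]
    intro z hz
    have hxz : x ≤ z := by
      by_contra h
      exact hz (by simp [Icc_eq_empty h])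
    by_cases h : ∃ c, x ≤ c ∧ c < z ∧ c ∉ u
    · obtain ⟨c, hxc, hcz, hcu⟩ := h
      exact ⟨Ioi c, fun w hw hw' => hcu (hw' ⟨hxc, le_of_lt hw⟩), hX.isOpen_Ioi c, hcz⟩
    -- Now `z` is the first point where `[x, z]` leaves `u`, hence `z ∈ v`. A convex neighbourhood
    -- of `z` inside `v` cannot meet the segment, since otherwise `u` and `v` would meet in `[x,
    -- a]`.
    · push Not at h
      have hzu : z ∉ u := by
        intro hzu
        refine hz fun c hc => ?_
        rcases hc.2.lt_or_eq with h1 | rfl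
        · exact h c hc.1 h1
        · exact hzu
      have hzy : z ≤ y := by
        by_contra h1
        exact hyu (h y hxy (not_le.1 h1))
      have hzv : z ∈ v := (huv ⟨hxz, hzy.trans hya⟩).resolve_left hzu
      obtain ⟨W, hWo, hzW, hWv, hWc⟩ := hX.exists_ordConnected_nhd hv hzv
      refine ⟨W, fun w hw hw' => ?_, hWo, hzW⟩
      rcases lt_or_ge w z with h1 | h1
      · rcases le_total x w with h2 | h2
        · exact hd ⟨w, ⟨h2, h1.le.trans (hzy.trans hya)⟩, hw' ⟨h2, le_rfl⟩, hWv hw⟩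
        · exact hd ⟨x, ⟨le_rfl, hxy.trans hya⟩, hxu, hWv (hWc.out hw hzW ⟨h2, hxz⟩)⟩
      · exact hzu (hw' ⟨hxz, h1⟩)
  · rw [isOpen_iff_forall_mem_open]
    intro z hz
    rcases lt_or_ge z x with h | h
    · exact ⟨Iio x, fun w hw c hc => absurd (hc.1.trans hc.2) (not_le.2 hw), hX.isOpen_Iio x, h⟩
    · obtain ⟨W, hWo, hzW, hWu, hWc⟩ := hX.exists_ordConnected_nhd hu (hz ⟨h, le_rfl⟩)
      refine ⟨W, fun w hw c hc => ?_, hWo, hzW⟩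
      rcases le_total c z with h1 | h1
      · exact hz ⟨hc.1, h1⟩
      · exact hWu (hWc.out hzW hw ⟨h1, hc.2⟩)
  · intro c hc
    rw [le_antisymm hc.2 hc.1]
    exact hxu

/-- Points of different components are separated by a clopen initial segment. -/
theorem IsSuborderable.exists_isClopen_isLowerSet (hX : IsSuborderable X) {x a : X} (hxa : x < a)
    (h : a ∉ connectedComponent x) :
    ∃ L : Set X, IsClopen L ∧ IsLowerSet L ∧ x ∈ L ∧ a ∉ L := by
  have hn : ¬ IsPreconnected (Icc x a) := fun hp =>
    h (hp.subset_connectedComponent ⟨le_rfl, hxa.le⟩ ⟨hxa.le, le_rfl⟩)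
  unfold IsPreconnected at hn
  push Not at hn
  obtain ⟨u, v, hu, hv, huv, hnu, hnv, hd⟩ := hn
  rw [← not_nonempty_iff_eq_empty] at hd
  rcases huv ⟨le_rfl, hxa.le⟩ with hxu | hxv
  · exact hX.exists_isClopen_isLowerSet_of_separation hu hv huv hd hxu hnv
  · rw [union_comm] at huv
    rw [inter_comm u v] at hd
    exact hX.exists_isClopen_isLowerSet_of_separation hv hu huv hd hxv hnu

end Suborderable

/-! ### Components and clopen sets -/

section Components

variable {X : Type u} [TopologicalSpace X]

theorem isConnected_of_mem_components {K : Set X} (hK : K ∈ components X) : IsConnected K := by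
  obtain ⟨x, rfl⟩ := hK
  exact isConnected_connectedComponent

theorem isClosed_of_mem_components {K : Set X} (hK : K ∈ components X) : IsClosed K := by
  obtain ⟨x, rfl⟩ := hK
  exact isClosed_connectedComponent

theorem eq_connectedComponent_of_mem {K : Set X} (hK : K ∈ components X) {x : X} (hx : x ∈ K) :
    K = connectedComponent x := by
  obtain ⟨y, rfl⟩ := hK
  exact connectedComponent_eq hx

theorem eq_of_mem_components {K K' : Set X} (hK : K ∈ components X) (hK' : K' ∈ components X)
    {x : X} (hx : x ∈ K) (hx' : x ∈ K') : K = K' := by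
  rw [eq_connectedComponent_of_mem hK hx, eq_connectedComponent_of_mem hK' hx']

theorem subset_of_mem_componentsIn {U K : Set X} (hU : IsClopen U) (hK : K ∈ componentsIn U) :
    K ⊆ U :=
  (isConnected_of_mem_components hK.1).isPreconnected.subset_isClopen hU hK.2

theorem mem_componentsIn_of_subset {U K : Set X} (hK : K ∈ components X) (h : K ⊆ U) :
    K ∈ componentsIn U := by
  obtain ⟨x, hx⟩ := (isConnected_of_mem_components hK).nonempty
  exact ⟨hK, x, hx, h hx⟩

theorem connectedComponent_mem_componentsIn {U : Set X} {x : X} (hx : x ∈ U) :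
    connectedComponent x ∈ componentsIn U :=
  ⟨⟨x, rfl⟩, x, mem_connectedComponent, hx⟩

theorem sUnion_componentsIn {U : Set X} (hU : IsClopen U) : ⋃₀ componentsIn U = U := by
  refine Subset.antisymm (sUnion_subset fun K hK => subset_of_mem_componentsIn hU hK) ?_
  exact fun x hx => ⟨_, connectedComponent_mem_componentsIn hx, mem_connectedComponent⟩

theorem isClosed_sUnion_components {F : Set (Set X)} (hF : F.Finite) (h : F ⊆ components X) :
    IsClosed (⋃₀ F) := by
  rw [sUnion_eq_biUnion]
  exact hF.isClosed_biUnion fun K hK => isClosed_of_mem_components (h hK)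

/-- If a clopen set meets only finitely many components, then all of them are clopen. -/
theorem isClopen_of_finite_componentsIn {U K : Set X} (hU : IsClopen U)
    (hf : (componentsIn U).Finite) (hK : K ∈ componentsIn U) : IsClopen K := by
  refine ⟨isClosed_of_mem_components hK.1, ?_⟩
  have h : K = U \ ⋃₀ (componentsIn U \ {K}) := by
    ext x
    constructor
    · rintro hx
      refine ⟨subset_of_mem_componentsIn hU hK hx, ?_⟩
      rintro ⟨K', ⟨hK', hne⟩, hx'⟩
      exact hne (eq_of_mem_components hK'.1 hK.1 hx' hx)
    · rintro ⟨hx, hx'⟩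
      by_contra hxK
      refine hx' ⟨_, ⟨connectedComponent_mem_componentsIn hx, ?_⟩, mem_connectedComponent⟩
      rintro (h : connectedComponent x = K)
      exact hxK (h ▸ mem_connectedComponent)
  rw [h]
  exact hU.isOpen.sdiff (isClosed_sUnion_components (hf.subset sdiff_subset) fun K' hK' => hK'.1.1)

end Components

/-! ### The two sides of a component -/

section OrderComponents

variable {X : Type u} [LinearOrder X] {K : Set X}

theorem disjoint_openLeft : Disjoint (openLeft K) K :=
  Set.disjoint_left.2 fun x hx hxK => lt_irrefl x (hx x hxK)

theorem disjoint_openRight : Disjoint (openRight K) K :=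
  Set.disjoint_left.2 fun x hx hxK => lt_irrefl x (hx x hxK)

variable [TopologicalSpace X]

theorem IsSuborderable.mem_openLeft_or_mem_openRight (hX : IsSuborderable X)
    (hK : K ∈ components X) {x : X} (hx : x ∉ K) : x ∈ openLeft K ∨ x ∈ openRight K := by
  have hc := hX.ordConnected_of_isPreconnected (isConnected_of_mem_components hK).isPreconnected
  by_contra! h
  obtain ⟨h1, h2⟩ := h
  simp only [openLeft, openRight, mem_ofPred_eq, not_forall, not_lt] at h1 h2
  obtain ⟨a, ha, hax⟩ := h1
  obtain ⟨b, hb, hxb⟩ := h2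
  exact hx (hc.out ha hb ⟨hax, hxb⟩)

theorem disjoint_openLeft_openRight (hK : K ∈ components X) :
    Disjoint (openLeft K) (openRight K) := by
  obtain ⟨a, ha⟩ := (isConnected_of_mem_components hK).nonempty
  exact Set.disjoint_left.2 fun x hx hx' => lt_asymm (hx a ha) (hx' a ha)

theorem IsSuborderable.isOpen_openLeft (hX : IsSuborderable X) (hK : K ∈ components X) :
    IsOpen (openLeft K) := by
  rw [isOpen_iff_forall_mem_open]
  intro x hx
  obtain ⟨W, hWo, hxW, hWK, hWc⟩ := hX.exists_ordConnected_nhd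
    (isClosed_of_mem_components hK).isOpen_compl (disjoint_left.1 disjoint_openLeft hx)
  refine ⟨W, fun w hw k hk => ?_, hWo, hxW⟩
  by_contra! h
  exact hWK (hWc.out hxW hw ⟨(hx k hk).le, h⟩) hk

theorem IsSuborderable.isOpen_openRight (hX : IsSuborderable X) (hK : K ∈ components X) :
    IsOpen (openRight K) :=
  hX.dual.isOpen_openLeft (X := Xᵒᵈ) hK

theorem IsSuborderable.le_of_mem_closure_openLeft (hX : IsSuborderable X) {a b : X}
    (ha : a ∈ closure (openLeft K)) (hb : b ∈ K) : a ≤ b := by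
  by_contra! h
  obtain ⟨x, hx, hx'⟩ := mem_closure_iff.1 ha (Ioi b) (hX.isOpen_Ioi b) h
  exact lt_asymm (show b < x from hx) (hx' b hb)

theorem IsSuborderable.subsingleton_closure_openLeft_inter (hX : IsSuborderable X) :
    (closure (openLeft K) ∩ K).Subsingleton := fun _ ha _ hb =>
  le_antisymm (hX.le_of_mem_closure_openLeft ha.1 hb.2) (hX.le_of_mem_closure_openLeft hb.1 ha.2)

theorem arr_eq_ell_dual (K : Set X) : arr K = ell (X := Xᵒᵈ) K := by
  unfold arr ell
  rw [inter_comm]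
  rfl

theorem IsSuborderable.ell_le_one (hX : IsSuborderable X) : ell K ≤ 1 :=
  have := hX.subsingleton_closure_openLeft_inter (K := K).finite.to_subtype
  ncard_le_one_iff_subsingleton.2 hX.subsingleton_closure_openLeft_inter

theorem IsSuborderable.arr_le_one (hX : IsSuborderable X) : arr K ≤ 1 := by
  rw [arr_eq_ell_dual]
  exact hX.dual.ell_le_one

theorem IsSuborderable.ell_eq_zero_iff (hX : IsSuborderable X) :
    ell K = 0 ↔ closure (openLeft K) ∩ K = ∅ :=
  ncard_eq_zero (hs := hX.subsingleton_closure_openLeft_inter.finite)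

/-- A limit of the left side cannot lie in the open right side, and `ℓ(K) = 0` keeps it out of `K`.
-/
theorem IsSuborderable.isClopen_openLeft (hX : IsSuborderable X) (hK : K ∈ components X)
    (h : ell K = 0) : IsClopen (openLeft K) := by
  refine ⟨isClosed_of_closure_subset fun x hx => ?_, hX.isOpen_openLeft hK⟩
  have hxK : x ∉ K := fun hxK =>
    (Set.eq_empty_iff_forall_notMem.1 (hX.ell_eq_zero_iff.1 h)) x ⟨hx, hxK⟩
  refine (hX.mem_openLeft_or_mem_openRight hK hxK).resolve_right fun hr => ?_
  obtain ⟨y, hy, hy'⟩ := mem_closure_iff.1 hx _ (hX.isOpen_openRight hK) hr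
  exact disjoint_left.1 (disjoint_openLeft_openRight hK) hy' hy

theorem IsSuborderable.isClopen_openRight (hX : IsSuborderable X) (hK : K ∈ components X)
    (h : arr K = 0) : IsClopen (openRight K) :=
  hX.dual.isClopen_openLeft (X := Xᵒᵈ) hK (by rwa [← arr_eq_ell_dual])

/-- If `K` has a point `a` that is a limit from the left, a clopen initial segment is cut between
`a` and a nearby `x` on the left. It misses the connected set `K`, and what it leaves over lies
between `x` and `a`, in a convex neighbourhood inside `V`. -/
theorem IsSuborderable.exists_isClopen_openLeft_diff_subset (hX : IsSuborderable X)
    (hK : K ∈ components X) {V : Set X} (hV : IsOpen V) (hKV : K ⊆ V) :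
    ∃ L : Set X, IsClopen L ∧ Disjoint L K ∧ openLeft K \ L ⊆ V := by
  by_cases h : ell K = 0
  · exact ⟨_, hX.isClopen_openLeft hK h, disjoint_openLeft, by simp⟩
  · rw [hX.ell_eq_zero_iff] at h
    obtain ⟨a, ha, haK⟩ := nonempty_iff_ne_empty.2 h
    obtain ⟨W, hWo, haW, hWV, hWc⟩ := hX.exists_ordConnected_nhd hV (hKV haK)
    obtain ⟨x, hxW, hx⟩ := mem_closure_iff.1 ha W hWo haW
    have hax : a ∉ connectedComponent x := fun h' =>
      disjoint_left.1 disjoint_openLeft hx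
        (eq_of_mem_components hK ⟨x, rfl⟩ haK h' ▸ mem_connectedComponent)
    obtain ⟨L, hL, hLl, hxL, haL⟩ := hX.exists_isClopen_isLowerSet (hx a haK) hax
    refine ⟨L, hL, ?_, ?_⟩
    · rw [Set.disjoint_left]
      intro y hyL hyK
      exact haL ((isConnected_of_mem_components hK).isPreconnected.subset_isClopen hL
        ⟨y, hyK, hyL⟩ haK)
    · rintro y ⟨hy, hyL⟩
      refine hWV (hWc.out hxW haW ⟨?_, (hy a haK).le⟩)
      by_contra! hyx
      exact hyL (hLl hyx.le hxL)

/-- Components have a neighbourhood base of clopen sets. -/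
theorem IsSuborderable.exists_isClopen_between (hX : IsSuborderable X)
    (hK : K ∈ components X) {V : Set X} (hV : IsOpen V) (hKV : K ⊆ V) :
    ∃ G : Set X, IsClopen G ∧ K ⊆ G ∧ G ⊆ V := by
  obtain ⟨L, hL, hLK, hLV⟩ := hX.exists_isClopen_openLeft_diff_subset hK hV hKV
  obtain ⟨R, hR, hRK, hRV⟩ :
      ∃ R : Set X, IsClopen R ∧ Disjoint R K ∧ openRight K \ R ⊆ V :=
    hX.dual.exists_isClopen_openLeft_diff_subset (X := Xᵒᵈ) hK hV hKV
  refine ⟨Lᶜ ∩ Rᶜ, hL.compl.inter hR.compl, fun x hx =>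
    ⟨disjoint_right.1 hLK hx, disjoint_right.1 hRK hx⟩, ?_⟩
  rintro x ⟨hxL, hxR⟩
  by_cases hxK : x ∈ K
  · exact hKV hxK
  · rcases hX.mem_openLeft_or_mem_openRight hK hxK with h | h
    · exact hLV ⟨h, hxL⟩
    · exact hRV ⟨h, hxR⟩

/-- Off `K`, the left side is the complement of the right side, and both are open. -/
theorem IsSuborderable.isClopen_inter_openLeft (hX : IsSuborderable X) (hK : K ∈ components X)
    {W : Set X} (hW : IsClopen W) (hd : Disjoint W K) : IsClopen (W ∩ openLeft K) := by
  refine ⟨?_, hW.isOpen.inter (hX.isOpen_openLeft hK)⟩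
  have : W ∩ openLeft K = W ∩ (openRight K)ᶜ := by
    ext x
    refine and_congr_right fun hx => ⟨fun h => ?_, fun h => ?_⟩
    · exact disjoint_left.1 (disjoint_openLeft_openRight hK) h
    · exact (hX.mem_openLeft_or_mem_openRight hK (disjoint_left.1 hd hx)).resolve_right h
  rw [this]
  exact hW.isClosed.inter (hX.isOpen_openRight hK).isClosed_compl

theorem IsSuborderable.isClopen_inter_openRight (hX : IsSuborderable X) (hK : K ∈ components X)
    {W : Set X} (hW : IsClopen W) (hd : Disjoint W K) : IsClopen (W ∩ openRight K) :=
  hX.dual.isClopen_inter_openLeft (X := Xᵒᵈ) hK hW hd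

/-- If `ℓ(K) ≠ 0`, then every neighbourhood of `K` meets infinitely many components on the
left of `K`. -/
theorem IsSuborderable.infinite_componentsIn_inter_openLeft (hX : IsSuborderable X)
    (hK : K ∈ components X) (h : ell K ≠ 0) {U : Set X} (hU : IsOpen U) (hKU : K ⊆ U) :
    (componentsIn (U ∩ openLeft K)).Infinite := by
  intro hf
  rw [Ne, hX.ell_eq_zero_iff] at h
  obtain ⟨a, ha, haK⟩ := nonempty_iff_ne_empty.2 h
  -- Finitely many components have a closed union. It misses `a`, so it cannot exhaust the points of
  -- the left side close to `a`.
  have hcl := isClosed_sUnion_components hf fun K' hK' => hK'.1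
  have haF : a ∉ ⋃₀ componentsIn (U ∩ openLeft K) := by
    rintro ⟨K', hK', haK'⟩
    obtain ⟨y, hy, -, hy'⟩ := hK'.2
    rw [eq_of_mem_components hK'.1 hK haK' haK] at hy
    exact disjoint_left.1 disjoint_openLeft hy' hy
  obtain ⟨x, ⟨hxU, hxF⟩, hx⟩ := mem_closure_iff.1 ha _ (hU.sdiff hcl) ⟨hKU haK, haF⟩
  exact hxF ⟨_, connectedComponent_mem_componentsIn ⟨hxU, hx⟩, mem_connectedComponent⟩

theorem IsSuborderable.infinite_componentsIn_inter_openRight (hX : IsSuborderable X)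
    (hK : K ∈ components X) (h : arr K ≠ 0) {U : Set X} (hU : IsOpen U) (hKU : K ⊆ U) :
    (componentsIn (U ∩ openRight K)).Infinite :=
  hX.dual.infinite_componentsIn_inter_openLeft (X := Xᵒᵈ) hK (by rwa [← arr_eq_ell_dual]) hU hKU

end OrderComponents

/-! ### Convexity estimates and the local base 𝒟[X, ε] -/

section Metric

variable {X : Type u} [MetricSpace X] [LinearOrder X] {K : Set X}

theorem IsConvexMetric.dual (hρ : IsConvexMetric X) : IsConvexMetric Xᵒᵈ := by
  intro x a b y hxa hab hby
  have := hρ y b a x hby hab hxa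
  rwa [dist_comm, dist_comm x y]

theorem openNhd_eq_thickening {X : Type u} [MetricSpace X] (A : Set X) (ε : ℝ) :
    openNhd A ε = Metric.thickening ε A :=
  Metric.thickening_eq_biUnion_ball.symm

/-- A point `c` of `K` within `η` of the leftmost of two points lies to the right of both. Convexity
therefore gives the bound `η`, where the triangle inequality would also involve the diameter of `K`.
-/
theorem IsConvexMetric.ediam_openNhd_inter_openLeft_le (hρ : IsConvexMetric X) (K : Set X)
    (η : ℝ) : Metric.ediam (openNhd K η ∩ openLeft K) ≤ ENNReal.ofReal η := by
  have key : ∀ x y : X, x ≤ y → x ∈ openNhd K η → y ∈ openLeft K → dist x y ≤ η := by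
    intro x y hxy hx hy
    simp only [openNhd, mem_iUnion, Metric.mem_ball] at hx
    obtain ⟨c, hc, hxc⟩ := hx
    exact (hρ x x y c le_rfl hxy (hy c hc).le).trans hxc.le
  refine Metric.ediam_le fun x hx y hy => ?_
  rw [edist_dist]
  refine ENNReal.ofReal_le_ofReal ?_
  rcases le_total x y with h | h
  · exact key x y h hx.1 hy.2
  · rw [dist_comm]
    exact key y x h hy.1 hx.2

theorem IsConvexMetric.ediam_openNhd_inter_openRight_le (hρ : IsConvexMetric X) (K : Set X)
    (η : ℝ) : Metric.ediam (openNhd K η ∩ openRight K) ≤ ENNReal.ofReal η :=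
  hρ.dual.ediam_openNhd_inter_openLeft_le (X := Xᵒᵈ) K η

theorem subset_openNhd {X : Type u} [MetricSpace X] {K : Set X} {ε : ℝ} (hε : 0 < ε) :
    K ⊆ openNhd K ε := by
  rw [openNhd_eq_thickening]
  exact Metric.self_subset_thickening hε K

theorem Delta_subset_openNhd {ε : ℝ} (hε : 0 < ε) : Delta K ε ⊆ openNhd K (ε / 2) := by
  unfold Delta
  split_ifs
  · exact subset_openNhd (half_pos hε)
  · exact inter_subset_left
  · exact inter_subset_left
  · exact subset_rfl

theorem subset_Delta {ε : ℝ} (hε : 0 < ε) : K ⊆ Delta K ε := by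
  have h := subset_openNhd (K := K) (half_pos hε)
  unfold Delta
  split_ifs
  · exact subset_rfl
  · exact fun x hx => ⟨h hx, fun h' => lt_irrefl x (h' x hx)⟩
  · exact fun x hx => ⟨h hx, fun h' => lt_irrefl x (h' x hx)⟩
  · exact h

/-- A side is cut off only when its number `ℓ` or `r` vanishes, and then that side is clopen. -/
theorem IsSuborderable.isOpen_Delta (hX : IsSuborderable X) (hK : K ∈ components X) (ε : ℝ) :
    IsOpen (Delta K ε) := by
  have h : IsOpen (openNhd K (ε / 2)) := by
    rw [openNhd_eq_thickening]
    exact Metric.isOpen_thickening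
  unfold Delta
  split_ifs with h1 h2 h3
  · have : K = (openLeft K)ᶜ ∩ (openRight K)ᶜ := by
      ext x
      constructor
      · exact fun hx => ⟨disjoint_right.1 disjoint_openLeft hx,
          disjoint_right.1 disjoint_openRight hx⟩
      · rintro ⟨hl, hr⟩
        by_contra hx
        exact (hX.mem_openLeft_or_mem_openRight hK hx).elim hl hr
    rw [this]
    exact (hX.isClopen_openLeft hK h1.1).compl.isOpen.inter
      (hX.isClopen_openRight hK h1.2).compl.isOpen
  · exact h.inter (hX.isClopen_openRight hK h2.2).compl.isOpen
  · exact h.inter (hX.isClopen_openLeft hK h3.1).compl.isOpen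
  · exact h

/-- Every component of `O(C, η)` other than `C` has diameter at most `η`. -/
theorem IsConvexMetric.ediam_le_of_subset_openNhd (hX : IsSuborderable X) (hρ : IsConvexMetric X)
    {C : Set X} (hC : C ∈ components X) (hK : K ∈ components X) (hne : K ≠ C) {η : ℝ}
    (h : K ⊆ openNhd C η) : Metric.ediam K ≤ ENNReal.ofReal η := by
  have hd : Disjoint K C := Set.disjoint_left.2 fun x hx hx' =>
    hne (eq_of_mem_components hK hC hx hx')
  have hl := hX.isOpen_openLeft hC
  have hr := hX.isOpen_openRight hC
  rcases (isConnected_of_mem_components hK).isPreconnected.subset_or_subset hl hr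
    (disjoint_openLeft_openRight hC)
    (fun x hx => hX.mem_openLeft_or_mem_openRight hC (disjoint_left.1 hd hx)) with h' | h'
  · exact (Metric.ediam_mono (subset_inter h h')).trans
      (hρ.ediam_openNhd_inter_openLeft_le C η)
  · exact (Metric.ediam_mono (subset_inter h h')).trans
      (hρ.ediam_openNhd_inter_openRight_le C η)

theorem ediam_openNhd_le {X : Type u} [MetricSpace X] (A : Set X) {η : ℝ} (hη : 0 ≤ η) :
    Metric.ediam (openNhd A η) ≤ Metric.ediam A + 2 * ENNReal.ofReal η := by
  rw [openNhd_eq_thickening]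
  lift η to NNReal using hη
  rw [ENNReal.ofReal_coe_nnreal]
  exact Metric.ediam_thickening_le η

/-- The members of `𝒟[X, ε]` form a neighbourhood base at each component. -/
theorem exists_mem_clopenFamilyWithin (hX : IsSuborderable X) {ε : ℝ} (hε : 0 < ε)
    (hK : K ∈ components X) {V : Set X} (hV : IsOpen V) (hKV : K ⊆ V) :
    ∃ G ∈ clopenFamilyWithin X ε, K ⊆ G ∧ G ⊆ V := by
  -- Any set between `K` and `N` meets the size condition: `N` is a thin tube if `diam K < ε`, and
  -- `Δ(K, ε)` otherwise.
  obtain ⟨N, hNo, hKN, hN⟩ : ∃ N : Set X, IsOpen N ∧ K ⊆ N ∧ ∀ G : Set X, K ⊆ G → G ⊆ N →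
      Metric.ediam G < ENNReal.ofReal ε ∨ ∃ C ∈ largeComponents ε G, G ⊆ Delta C ε := by
    rcases lt_or_ge (Metric.ediam K) (ENNReal.ofReal ε) with h | h
    · obtain ⟨d, hd⟩ : ∃ d : ℝ, 0 ≤ d ∧ Metric.ediam K = ENNReal.ofReal d :=
        ⟨(Metric.ediam K).toReal, ENNReal.toReal_nonneg, (ENNReal.ofReal_toReal h.ne_top).symm⟩
      rw [hd.2] at h
      have hdε : d < ε := (ENNReal.ofReal_lt_ofReal_iff hε).1 h
      -- The tube has diameter at most `d + 2(ε - d)/3 < ε`.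
      refine ⟨openNhd K ((ε - d) / 3), ?_, subset_openNhd (by linarith), fun G _ hG => Or.inl ?_⟩
      · rw [openNhd_eq_thickening]
        exact Metric.isOpen_thickening
      · refine (Metric.ediam_mono hG).trans_lt
          ((ediam_openNhd_le K (by linarith)).trans_lt ?_)
        rw [hd.2, ← ENNReal.ofReal_ofNat 2, ← ENNReal.ofReal_mul (by norm_num),
          ← ENNReal.ofReal_add hd.1 (by linarith), ENNReal.ofReal_lt_ofReal_iff hε]
        linarith
    · exact ⟨Delta K ε, hX.isOpen_Delta hK ε, subset_Delta hε, fun G hKG hG =>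
        Or.inr ⟨K, ⟨mem_componentsIn_of_subset hK hKG, h⟩, hG⟩⟩
  obtain ⟨G, hG, hKG, hGV⟩ := hX.exists_isClopen_between hK (hV.inter hNo) (subset_inter hKV hKN)
  -- A set with finitely many components need not belong to 𝒟[X], but then `K` itself is clopen and
  -- can replace `G`.
  by_cases hf : (componentsIn G).Finite
  · exact ⟨K, ⟨⟨isClopen_of_finite_componentsIn hG hf (mem_componentsIn_of_subset hK hKG),
      Or.inl hK⟩, hN K subset_rfl hKN⟩, subset_rfl, hKV⟩
  · exact ⟨G, ⟨⟨hG, Or.inr hf⟩, hN G hKG (hGV.trans inter_subset_right)⟩, hKG,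
      hGV.trans inter_subset_left⟩

/-- The members of `𝒟[X]` are nonempty. -/
theorem nonempty_of_mem_clopenFamily {X : Type u} [TopologicalSpace X] {U : Set X}
    (hU : U ∈ clopenFamily X) : U.Nonempty := by
  rcases hU.2 with h | h
  · exact (isConnected_of_mem_components h).nonempty
  · obtain ⟨K, hK⟩ := h.nonempty
    exact hK.2.mono inter_subset_right

/-- Clopen components belong to `𝒟[X, ε]`. -/
theorem mem_clopenFamilyWithin_of_mem_components {ε : ℝ} (hε : 0 < ε) (hK : K ∈ components X)
    (hc : IsClopen K) : K ∈ clopenFamilyWithin X ε := by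
  refine ⟨⟨hc, Or.inl hK⟩, ?_⟩
  rcases lt_or_ge (Metric.ediam K) (ENNReal.ofReal ε) with h | h
  · exact Or.inl h
  · exact Or.inr ⟨K, ⟨mem_componentsIn_of_subset hK subset_rfl, h⟩, subset_Delta hε⟩

end Metric

/-! ### Fine partitions and divisible sets -/

section Partition

variable {X : Type u} [MetricSpace X] [LinearOrder X] {ε : ℝ}

/-- `P` is a partition of `W` into members of `𝒟[X, ε]`. -/
structure IsFinePartition (ε : ℝ) (W : Set X) (P : Set (Set X)) : Prop where
  subset : P ⊆ clopenFamilyWithin X ε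
  disjoint : P.PairwiseDisjoint id
  sUnion_eq : ⋃₀ P = W

theorem IsFinePartition.iUnion {ι : Type*} {W : ι → Set X} {P : ι → Set (Set X)}
    (h : ∀ i, IsFinePartition ε (W i) (P i)) (hd : Pairwise (Function.onFun Disjoint W)) :
    IsFinePartition ε (⋃ i, W i) (⋃ i, P i) := by
  refine ⟨iUnion_subset fun i => (h i).subset, ?_, ?_⟩
  · intro A hA B hB hAB
    obtain ⟨i, hi⟩ := mem_iUnion.1 hA
    obtain ⟨j, hj⟩ := mem_iUnion.1 hB
    by_cases hij : i = j
    · subst hij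
      exact (h i).disjoint hi hj hAB
    · refine (hd hij).mono ?_ ?_
      · rw [← (h i).sUnion_eq]; exact subset_sUnion_of_mem hi
      · rw [← (h j).sUnion_eq]; exact subset_sUnion_of_mem hj
  · rw [sUnion_iUnion]
    exact iUnion_congr fun i => (h i).sUnion_eq

theorem IsFinePartition.union {W₁ W₂ : Set X} {P₁ P₂ : Set (Set X)}
    (h₁ : IsFinePartition ε W₁ P₁) (h₂ : IsFinePartition ε W₂ P₂) (hd : Disjoint W₁ W₂) :
    IsFinePartition ε (W₁ ∪ W₂) (P₁ ∪ P₂) := by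
  have := IsFinePartition.iUnion (W := fun b : Bool => cond b W₁ W₂)
    (P := fun b : Bool => cond b P₁ P₂) (ε := ε) (by rintro (_ | _) <;> assumption)
    (by
      rintro (_ | _) (_ | _) h
      · exact absurd rfl h
      · exact hd.symm
      · exact hd
      · exact absurd rfl h)
  rw [← union_eq_iUnion, ← union_eq_iUnion] at this
  exact this

theorem isFinePartition_singleton {W : Set X} (hW : W ∈ clopenFamilyWithin X ε) :
    IsFinePartition ε W {W} :=
  ⟨by simpa using hW, pairwiseDisjoint_singleton _ _, sUnion_singleton W⟩

theorem isFinePartition_componentsIn (hε : 0 < ε) {W : Set X} (hW : IsClopen W)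
    (hf : (componentsIn W).Finite) : IsFinePartition ε W (componentsIn W) := by
  refine ⟨fun K hK => mem_clopenFamilyWithin_of_mem_components hε hK.1
    (isClopen_of_finite_componentsIn hW hf hK), ?_, sUnion_componentsIn hW⟩
  exact fun K hK K' hK' hne => Set.disjoint_left.2 fun x hx hx' =>
    hne (eq_of_mem_components hK.1 hK'.1 hx hx')

/-- A clopen set of the right size fails to be in 𝒟[X, ε] only if it has finitely many components;
these are then clopen and form the partition. -/
theorem exists_isFinePartition_of_large (hε : 0 < ε) {W : Set X} (hW : IsClopen W)
    (h : Metric.ediam W < ENNReal.ofReal ε ∨ ∃ C ∈ largeComponents ε W, W ⊆ Delta C ε) :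
    ∃ P, IsFinePartition ε W P := by
  by_cases hf : (componentsIn W).Finite
  · exact ⟨_, isFinePartition_componentsIn hε hW hf⟩
  · exact ⟨_, isFinePartition_singleton ⟨⟨hW, Or.inr hf⟩, h⟩⟩

/-- All clopen subsets of `W` have a partition into members of `𝒟[X, ε]`. -/
def IsDivisible (ε : ℝ) (W : Set X) : Prop :=
  ∀ V ⊆ W, IsClopen V → ∃ P, IsFinePartition ε V P

theorem IsDivisible.mono {W W' : Set X} (h : IsDivisible ε W) (hW : W' ⊆ W) :
    IsDivisible ε W' := fun V hV => h V (hV.trans hW)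

theorem isDivisible_of_ediam_lt (hε : 0 < ε) {W : Set X}
    (h : Metric.ediam W < ENNReal.ofReal ε) : IsDivisible ε W := fun _ hVW hV =>
  exists_isFinePartition_of_large hε hV (Or.inl ((Metric.ediam_mono hVW).trans_lt h))

theorem IsDivisible.of_diff {A W : Set X} (hA : IsClopen A) (h : IsDivisible ε A)
    (h' : IsDivisible ε (W \ A)) : IsDivisible ε W := by
  intro V hVW hV
  obtain ⟨P, hP⟩ := h (V ∩ A) inter_subset_right (hV.inter hA)
  obtain ⟨Q, hQ⟩ := h' (V \ A) (sdiff_subset_sdiff_left hVW) (hV.diff hA)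
  refine ⟨P ∪ Q, ?_⟩
  rw [← inter_union_sdiff V A]
  exact hP.union hQ (Set.disjoint_left.2 fun x hx hx' => hx'.2 hx.2)

/-- Since divisibility concerns all clopen subsets, the union may be made disjoint first. -/
theorem IsDivisible.iUnion_nat {W : ℕ → Set X} (hW : ∀ n, IsClopen (W n))
    (h : ∀ n, IsDivisible ε (W n)) : IsDivisible ε (⋃ n, W n) := by
  intro V hVW hV
  have hc : ∀ n, IsClopen (disjointed W n) := fun n =>
    disjointedRec (f := W) (p := IsClopen) (fun t i ht => ht.diff (hW i)) (hW n)
  have hP : ∀ n, ∃ P, IsFinePartition ε (V ∩ disjointed W n) P := fun n =>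
    h n _ (inter_subset_right.trans (disjointed_subset W n)) (hV.inter (hc n))
  choose P hP using hP
  refine ⟨⋃ n, P n, ?_⟩
  have hu : V = ⋃ n, V ∩ disjointed W n := by
    rw [← inter_iUnion, iUnion_disjointed, inter_eq_left.2 hVW]
  rw [hu]
  exact IsFinePartition.iUnion hP fun i j hij =>
    (disjoint_disjointed W hij).mono inter_subset_right inter_subset_right

/-- If `G ⊆ Δ(C, ε)`, a clopen subset meeting `C` satisfies the same condition with the same `C`. A
clopen subset missing `C` splits into its parts left and right of `C`, both of diameter at most `ε /
2`. -/
theorem isDivisible_of_mem_clopenFamilyWithin (hX : IsSuborderable X) (hρ : IsConvexMetric X)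
    (hε : 0 < ε) {G : Set X} (hG : G ∈ clopenFamilyWithin X ε) : IsDivisible ε G := by
  obtain ⟨⟨hGc, -⟩, h | ⟨C, hC, hGC⟩⟩ := hG
  · exact isDivisible_of_ediam_lt hε h
  intro V hVG hV
  by_cases hCV : (C ∩ V).Nonempty
  · exact exists_isFinePartition_of_large hε hV
      (Or.inr ⟨C, ⟨⟨hC.1.1, hCV⟩, hC.2⟩, hVG.trans hGC⟩)
  · have hd : Disjoint V C := by
      rwa [disjoint_comm, Set.disjoint_iff_inter_eq_empty, ← not_nonempty_iff_eq_empty]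
    have hlt : ENNReal.ofReal (ε / 2) < ENNReal.ofReal ε :=
      (ENNReal.ofReal_lt_ofReal_iff hε).2 (half_lt_self hε)
    have hVo : V ⊆ openNhd C (ε / 2) := hVG.trans (hGC.trans (Delta_subset_openNhd hε))
    obtain ⟨P, hP⟩ := exists_isFinePartition_of_large hε
      (hX.isClopen_inter_openLeft hC.1.1 hV hd) (Or.inl <|
        (Metric.ediam_mono (inter_subset_inter_left _ hVo)).trans_lt
        ((hρ.ediam_openNhd_inter_openLeft_le C _).trans_lt hlt))
    obtain ⟨Q, hQ⟩ := exists_isFinePartition_of_large hε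
      (hX.isClopen_inter_openRight hC.1.1 hV hd) (Or.inl <|
        (Metric.ediam_mono (inter_subset_inter_left _ hVo)).trans_lt
        ((hρ.ediam_openNhd_inter_openRight_le C _).trans_lt hlt))
    refine ⟨P ∪ Q, ?_⟩
    have hu : V = V ∩ openLeft C ∪ V ∩ openRight C := by
      rw [← inter_union_distrib_left, eq_comm, inter_eq_left]
      exact fun x hx => hX.mem_openLeft_or_mem_openRight hC.1.1 (disjoint_left.1 hd hx)
    rw [hu]
    exact hP.union hQ ((disjoint_openLeft_openRight hC.1.1).mono inter_subset_right
      inter_subset_right)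

end Partition

/-! ### Half balls and chains of short steps -/

section Chains

variable {X : Type u} [MetricSpace X] [LinearOrder X]

theorem IsConvexMetric.ediam_le (hρ : IsConvexMetric X) {y : X} {r : ℝ} {M : Set X}
    (hM : ∀ z ∈ M, y ≤ z ∧ dist y z ≤ r) : Metric.ediam M ≤ ENNReal.ofReal r := by
  refine Metric.ediam_le fun a ha b hb => ?_
  rw [edist_dist]
  refine ENNReal.ofReal_le_ofReal ?_
  rcases le_total a b with h | h
  · exact (hρ y a b b (hM a ha).1 h le_rfl).trans (hM b hb).2
  · rw [dist_comm]
    exact (hρ y b a a (hM b hb).1 h le_rfl).trans (hM a ha).2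

/-- A right half ball is contained in a clopen set which is small up to two given
neighbourhoods. -/
theorem exists_isClopen_right_half_ball (hX : IsSuborderable X) (hρ : IsConvexMetric X)
    {G : X → Set X} (hG : ∀ x, IsClopen (G x)) (hxG : ∀ x, x ∈ G x) (y : X) (δ : ℝ) (hδ : 0 < δ) :
    ∃ (z : X) (W : Set X), IsClopen W ∧ {w | y ≤ w ∧ dist y w < δ} ⊆ W ∧
      Metric.ediam (W \ (G y ∪ G z)) ≤ ENNReal.ofReal (2 * δ) := by
  -- If such a `z` exists, `[y, z]` contains the half ball, and `G y` and `G z` absorb the endpoints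
  -- that may spoil its openness.
  by_cases h : ∃ z, y < z ∧ δ ≤ dist y z ∧ dist y z < 2 * δ
  · obtain ⟨z, hyz, hz, hz'⟩ := h
    refine ⟨z, G y ∪ G z ∪ Icc y z, ⟨((hG y).isClosed.union (hG z).isClosed).union ?_, ?_⟩,
      ?_, ?_⟩
    · exact (hX.isClosed_Ici y).inter (hX.isClosed_Iic z)
    · have : G y ∪ G z ∪ Icc y z = G y ∪ G z ∪ (Ioi y ∩ Iio z) := by
        refine Subset.antisymm (union_subset subset_union_left fun w hw => ?_)
          (union_subset_union_right _ fun w hw => ⟨le_of_lt hw.1, le_of_lt hw.2⟩)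
        rcases hw.1.eq_or_lt with rfl | h1
        · exact Or.inl (Or.inl (hxG _))
        rcases hw.2.eq_or_lt with rfl | h2
        · exact Or.inl (Or.inr (hxG _))
        exact Or.inr ⟨h1, h2⟩
      rw [this]
      exact ((hG y).isOpen.union (hG z).isOpen).union
        ((hX.isOpen_Ioi y).inter (hX.isOpen_Iio z))
    · rintro w ⟨hyw, hw⟩
      refine Or.inr ⟨hyw, ?_⟩
      by_contra! hzw
      exact absurd (hρ y y z w le_rfl hyz.le hzw.le) (by linarith)
    · refine hρ.ediam_le (y := y) fun w hw => ?_
      have := hw.1.resolve_left hw.2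
      exact ⟨this.1, (hρ y y w z le_rfl this.1 this.2).trans hz'.le⟩
  -- Distances from `y` to the right skip `[δ, 2δ)`, so the half ball is also cut out by the closed
  -- ball of radius `3δ/2`. Only the endpoint `y` must be absorbed.
  · push Not at h
    refine ⟨y, G y ∪ {w | y ≤ w ∧ dist y w < δ}, ⟨?_, ?_⟩, subset_union_right, ?_⟩
    · have : {w | y ≤ w ∧ dist y w < δ} = Ici y ∩ Metric.closedBall y (3 / 2 * δ) := by
        ext w
        simp only [mem_ofPred_eq, mem_inter_iff, mem_Ici, Metric.mem_closedBall']
        refine and_congr_right fun hyw => ⟨fun h' => by linarith, fun h' => ?_⟩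
        by_contra! hw
        rcases hyw.eq_or_lt with rfl | h1
        · rw [dist_self] at hw
          linarith
        · have := h w h1 hw
          linarith
      rw [this]
      exact (hG y).isClosed.union ((hX.isClosed_Ici y).inter Metric.isClosed_closedBall)
    · have : G y ∪ {w | y ≤ w ∧ dist y w < δ} = G y ∪ (Ioi y ∩ Metric.ball y δ) := by
        refine Subset.antisymm (union_subset subset_union_left ?_)
          (union_subset_union_right _ ?_)
        · rintro w ⟨hyw, hw⟩
          rcases hyw.eq_or_lt with rfl | h1
          · exact Or.inl (hxG _)
          · exact Or.inr ⟨h1, Metric.mem_ball'.2 hw⟩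
        · exact fun w hw => ⟨le_of_lt hw.1, Metric.mem_ball'.1 hw.2⟩
      rw [this]
      exact (hG y).isOpen.union ((hX.isOpen_Ioi y).inter Metric.isOpen_ball)
    · refine hρ.ediam_le (y := y) fun w hw => ?_
      have hw' := hw.1.resolve_left fun h' => hw.2 (Or.inl h')
      exact ⟨hw'.1, by linarith [hw'.2]⟩

/-- The points on the right of `x` which are reached from `x` by finitely many steps of length
less than `δ` are covered by countably many `δ`-balls. -/
theorem exists_countable_right_cover (hρ : IsConvexMetric X) (x : X) {δ : ℝ} (hδ : 0 < δ) :
    ∃ S : Set X, S.Countable ∧ ∀ z, x ≤ z → (∃ n, z ∈ (Metric.thickening δ)^[n] {x}) →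
      ∃ y ∈ S, dist y z < δ := by
  set R : ℕ → Set X := fun n => (Metric.thickening δ)^[n] {x} with hR
  have hsucc : ∀ n, R (n + 1) = Metric.thickening δ (R n) := fun n =>
    Function.iterate_succ_apply' _ _ _
  have hmono : ∀ n, R n ⊆ R (n + 1) := fun n => by
    rw [hsucc]
    exact Metric.self_subset_thickening hδ _
  have hconv : ∀ n a b, x ≤ b → b ≤ a → a ∈ R n → b ∈ R n := by
    intro n
    induction n with
    | zero =>
      rintro a b hxb hba (rfl : a = x)
      exact le_antisymm hba hxb
    | succ n ih =>
      intro a b hxb hba ha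
      rw [hsucc, Metric.mem_thickening_iff] at ha
      obtain ⟨w, hw, haw⟩ := ha
      rcases le_total b w with h | h
      · exact hmono n (ih w b hxb h hw)
      · rw [hsucc, Metric.mem_thickening_iff]
        refine ⟨w, hw, ?_⟩
        rw [dist_comm] at haw ⊢
        exact (hρ w w b a le_rfl h hba).trans_lt haw
  -- Two points of the shell `R (n + 1) \ R n` to the right of `x` are less than `δ` apart: the
  -- point of `R n` close to the right one lies left of both. Hence one centre per shell suffices.
  have hstep : ∀ n y z, x ≤ y → y ≤ z → y ∉ R n → z ∈ R (n + 1) → dist y z < δ := by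
    intro n y z hxy hyz hy hz
    rw [hsucc, Metric.mem_thickening_iff] at hz
    obtain ⟨w, hw, hzw⟩ := hz
    have hwy : w ≤ y := by
      by_contra! h
      exact hy (hconv n w y hxy h.le hw)
    rw [dist_comm] at hzw
    exact (hρ w y z z hwy hyz le_rfl).trans_lt hzw
  have hc : ∀ n, ∃ y : X, ∀ z, x ≤ z → z ∉ R n → z ∈ R (n + 1) → dist y z < δ := by
    intro n
    by_cases h : ∃ y, x ≤ y ∧ y ∉ R n ∧ y ∈ R (n + 1)
    · obtain ⟨y, hxy, hy, hy'⟩ := h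
      refine ⟨y, fun z hxz hz hz' => ?_⟩
      rcases le_total y z with h | h
      · exact hstep n y z hxy h hy hz'
      · rw [dist_comm]
        exact hstep n z y hxz h hz hy'
    · exact ⟨x, fun z hxz hz hz' => absurd ⟨z, hxz, hz, hz'⟩ h⟩
  choose c hc using hc
  refine ⟨insert x (range c), (countable_range c).insert x, fun z hxz hz => ?_⟩
  obtain ⟨n, hn⟩ := hz
  change z ∈ R n at hn
  induction n with
  | zero =>
    obtain rfl : z = x := hn
    exact ⟨z, mem_insert _ _, by rwa [dist_self]⟩
  | succ n ih =>
    by_cases h : z ∈ R n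
    · exact ih h
    · exact ⟨c n, mem_insert_of_mem _ (mem_range_self n), hc n z hxz h hn⟩

/-- A chain may turn back and forth, but iterated thickenings ignore direction, so the one-sided
cover and its order dual suffice. -/
theorem exists_countable_cover (hρ : IsConvexMetric X) (x : X) {δ : ℝ} (hδ : 0 < δ) :
    ∃ S : Set X, S.Countable ∧ S.Nonempty ∧
      ∀ z, Relation.ReflTransGen (fun a b : X => dist a b < δ) x z → ∃ y ∈ S, dist y z < δ := by
  obtain ⟨S, hS, hS'⟩ := exists_countable_right_cover hρ x hδ
  obtain ⟨S₂, hS₂, hS₂'⟩ : ∃ S : Set X, S.Countable ∧ ∀ z, z ≤ x →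
      (∃ n, z ∈ (Metric.thickening δ)^[n] {x}) → ∃ y ∈ S, dist y z < δ :=
    exists_countable_right_cover (X := Xᵒᵈ) hρ.dual x hδ
  refine ⟨insert x (S ∪ S₂), (hS.union hS₂).insert x, insert_nonempty _ _, fun z hz => ?_⟩
  have hn : ∃ n, z ∈ (Metric.thickening δ)^[n] {x} := by
    induction hz with
    | refl => exact ⟨0, rfl⟩
    | tail _ h ih =>
      obtain ⟨n, hn⟩ := ih
      refine ⟨n + 1, ?_⟩
      rw [Function.iterate_succ_apply', Metric.mem_thickening_iff]
      exact ⟨_, hn, by rwa [dist_comm]⟩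
  rcases le_total x z with h | h
  · obtain ⟨y, hy, hyz⟩ := hS' z h hn
    exact ⟨y, Or.inr (Or.inl hy), hyz⟩
  · obtain ⟨y, hy, hyz⟩ := hS₂' z h hn
    exact ⟨y, Or.inr (Or.inr hy), hyz⟩

end Chains

/-! ### Fine partitions of arbitrary clopen sets -/

section Divisible

variable {X : Type u} [MetricSpace X] [LinearOrder X] {ε : ℝ}

/-- With radius `ε / 4`, each half ball lies in a clopen set which, outside two divisible
neighbourhoods, has diameter at most `ε / 2`. -/
theorem exists_isDivisible_ball_subset (hX : IsSuborderable X) (hρ : IsConvexMetric X)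
    (hε : 0 < ε) (y : X) :
    ∃ W : Set X, IsClopen W ∧ IsDivisible ε W ∧ Metric.ball y (ε / 4) ⊆ W := by
  have hG : ∀ x : X, ∃ G ∈ clopenFamilyWithin X ε, x ∈ G := fun x => by
    obtain ⟨G, hG, hxG, -⟩ := exists_mem_clopenFamilyWithin hX hε ⟨x, rfl⟩ isOpen_univ
      (subset_univ (connectedComponent x))
    exact ⟨G, hG, hxG mem_connectedComponent⟩
  choose G hG hxG using hG
  have hδ : 0 < ε / 4 := by linarith
  have hlt : ENNReal.ofReal (2 * (ε / 4)) < ENNReal.ofReal ε :=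
    (ENNReal.ofReal_lt_ofReal_iff hε).2 (by linarith)
  have hdiv : ∀ (z : X) (W : Set X),
      Metric.ediam (W \ (G y ∪ G z)) ≤ ENNReal.ofReal (2 * (ε / 4)) → IsDivisible ε W := by
    intro z W h
    refine .of_diff (hG y).1.1 (isDivisible_of_mem_clopenFamilyWithin hX hρ hε (hG y)) ?_
    refine .of_diff (hG z).1.1 (isDivisible_of_mem_clopenFamilyWithin hX hρ hε (hG z)) ?_
    rw [sdiff_sdiff]
    exact isDivisible_of_ediam_lt hε (h.trans_lt hlt)
  obtain ⟨z, W, hW, hyW, hd⟩ := exists_isClopen_right_half_ball hX hρ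
    (fun x => (hG x).1.1) hxG y (ε / 4) hδ
  obtain ⟨z', W', hW', hyW', hd'⟩ : ∃ (z : X) (W : Set X), IsClopen W ∧
      {w | w ≤ y ∧ dist y w < ε / 4} ⊆ W ∧
      Metric.ediam (W \ (G y ∪ G z)) ≤ ENNReal.ofReal (2 * (ε / 4)) :=
    exists_isClopen_right_half_ball (X := Xᵒᵈ) hX.dual hρ.dual
      (fun x => (hG x).1.1) hxG y (ε / 4) hδ
  refine ⟨W ∪ W', hW.union hW', .of_diff hW (hdiv z W hd) ?_, fun w hw => ?_⟩
  · rw [union_sdiff_left]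
    exact (hdiv z' W' hd').mono sdiff_subset
  · rw [Metric.mem_ball'] at hw
    rcases le_total y w with h | h
    · exact Or.inl (hyW ⟨h, hw⟩)
    · exact Or.inr (hyW' ⟨h, hw⟩)

/-- Every clopen set has a partition into members of `𝒟[X, ε]`. -/
theorem exists_isFinePartition (hX : IsSuborderable X) (hρ : IsConvexMetric X) (hε : 0 < ε)
    {V : Set X} (hV : IsClopen V) : ∃ P, IsFinePartition ε V P := by
  -- The classes of this relation are clopen and pairwise disjoint, so each can be treated
  -- separately.
  set r : X → X → Prop := Relation.ReflTransGen fun a b : X => dist a b < ε / 4 with hr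
  have hδ : 0 < ε / 4 := by linarith
  have : Std.Symm fun a b : X => dist a b < ε / 4 := ⟨fun a b h => by rwa [dist_comm]⟩
  have hsymm : ∀ {a b}, r a b → r b a := fun h => Relation.ReflTransGen.stdSymm.symm _ _ h
  have hopen : ∀ x, IsOpen {z | r x z} := fun x => Metric.isOpen_iff.2 fun z hz =>
    ⟨ε / 4, hδ, fun w hw => hz.tail (Metric.mem_ball'.1 hw)⟩
  have hclopen : ∀ x, IsClopen {z | r x z} := fun x => by
    refine ⟨⟨Metric.isOpen_iff.2 fun z hz => ⟨ε / 4, hδ, fun w hw hw' => hz ?_⟩⟩, hopen x⟩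
    exact Relation.ReflTransGen.tail hw' hw
  have hdiv : ∀ x, IsDivisible ε {z | r x z} := by
    intro x
    obtain ⟨S, hS, hne, hcov⟩ := exists_countable_cover hρ x hδ
    obtain ⟨f, rfl⟩ := hS.exists_eq_range hne
    choose W hW hWd hWb using exists_isDivisible_ball_subset hX hρ hε
    refine (IsDivisible.iUnion_nat (fun n => hW (f n)) fun n => hWd (f n)).mono fun z hz => ?_
    obtain ⟨_, ⟨n, rfl⟩, hn⟩ := hcov z hz
    exact mem_iUnion.2 ⟨n, hWb _ (Metric.mem_ball'.2 hn)⟩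
  have hP : ∀ E : range fun x => {z | r x z}, ∃ P, IsFinePartition ε (V ∩ E.1) P := by
    rintro ⟨_, x, rfl⟩
    exact hdiv x _ inter_subset_right (hV.inter (hclopen x))
  choose P hP using hP
  refine ⟨⋃ E, P E, ?_⟩
  have hu : V = ⋃ E : range fun x => {z | r x z}, V ∩ E.1 := by
    rw [← inter_iUnion, eq_comm, inter_eq_left]
    exact fun x _ => mem_iUnion.2 ⟨⟨_, x, rfl⟩, Relation.ReflTransGen.refl⟩
  rw [hu]
  refine IsFinePartition.iUnion hP ?_
  rintro ⟨_, x, rfl⟩ ⟨_, y, rfl⟩ hne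
  refine Set.disjoint_left.2 fun z hz hz' => hne ?_
  have hxy : r x y := Relation.ReflTransGen.trans hz.2 (hsymm hz'.2)
  exact Subtype.ext (Set.ext fun w => ⟨fun h => Relation.ReflTransGen.trans (hsymm hxy) h,
    fun h => Relation.ReflTransGen.trans hxy h⟩)

end Divisible

/-! ### Splitting a set around its large component -/

section Splitting

variable {X : Type u} [MetricSpace X] [LinearOrder X] {ε : ℝ}

theorem IsFinePartition.subset_of_mem {W s : Set X} {P : Set (Set X)}
    (h : IsFinePartition ε W P) (hs : s ∈ P) : s ⊆ W := by
  rw [← h.sUnion_eq]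
  exact subset_sUnion_of_mem hs

theorem IsFinePartition.nonempty_of_mem {W s : Set X} {P : Set (Set X)}
    (h : IsFinePartition ε W P) (hs : s ∈ P) : s.Nonempty :=
  nonempty_of_mem_clopenFamily (h.subset hs).1

theorem IsFinePartition.disjoint_of_disjoint {W₁ W₂ : Set X} {P₁ P₂ : Set (Set X)}
    (h₁ : IsFinePartition ε W₁ P₁) (h₂ : IsFinePartition ε W₂ P₂) (hd : Disjoint W₁ W₂) :
    Disjoint P₁ P₂ := Set.disjoint_left.2 fun s hs hs' => by
  obtain ⟨x, hx⟩ := h₁.nonempty_of_mem hs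
  exact disjoint_left.1 hd (h₁.subset_of_mem hs hx) (h₂.subset_of_mem hs' hx)

/-- A clopen set with infinitely many components splits into two nonempty clopen sets, one of which
has infinitely many components. -/
theorem exists_isClopen_infinite_split {X : Type u} [TopologicalSpace X] [LinearOrder X]
    (hX : IsSuborderable X) {W : Set X} (hW : IsClopen W) (hi : (componentsIn W).Infinite) :
    ∃ A B : Set X, IsClopen A ∧ IsClopen B ∧ A ∪ B = W ∧ Disjoint A B ∧ B.Nonempty ∧
      (componentsIn A).Infinite := by
  obtain ⟨K, hK, K', hK', hne⟩ := hi.nontrivial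
  obtain ⟨x, hxK, hxW⟩ := hK.2
  obtain ⟨y, hyK, hyW⟩ := hK'.2
  obtain ⟨L, hL, hAn, hBn⟩ : ∃ L : Set X, IsClopen L ∧ (W ∩ L).Nonempty ∧ (W \ L).Nonempty := by
    have hd : ∀ z, z ∈ K → z ∈ K' → False := fun z h h' =>
      hne (eq_of_mem_components hK.1 hK'.1 h h')
    rcases lt_trichotomy x y with h | h | h
    · obtain ⟨L, hL, -, hxL, hyL⟩ := hX.exists_isClopen_isLowerSet h fun h' =>
        hd y ((eq_connectedComponent_of_mem hK.1 hxK).symm ▸ h') hyK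
      exact ⟨L, hL, ⟨x, hxW, hxL⟩, ⟨y, hyW, hyL⟩⟩
    · exact (hd x hxK (h ▸ hyK)).elim
    · obtain ⟨L, hL, -, hyL, hxL⟩ := hX.exists_isClopen_isLowerSet h fun h' =>
        hd x hxK ((eq_connectedComponent_of_mem hK'.1 hyK).symm ▸ h')
      exact ⟨L, hL, ⟨y, hyW, hyL⟩, ⟨x, hxW, hxL⟩⟩
  have hsub : componentsIn W ⊆ componentsIn (W ∩ L) ∪ componentsIn (W \ L) := by
    rintro C ⟨hC, z, hzC, hzW⟩
    by_cases hz : z ∈ L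
    · exact Or.inl ⟨hC, z, hzC, hzW, hz⟩
    · exact Or.inr ⟨hC, z, hzC, hzW, hz⟩
  rcases infinite_union.1 (hi.mono hsub) with h | h
  · exact ⟨_, _, hW.inter hL, hW.diff hL, inter_union_sdiff W L, disjoint_sdiff_inter.symm, hBn, h⟩
  · exact ⟨_, _, hW.diff hL, hW.inter hL, sdiff_union_inter W L, disjoint_sdiff_inter, hAn, h⟩

/-- Each split sets aside a nonempty part and keeps infinitely many components in the other, so it
can be repeated. -/
theorem exists_isFinePartition_le_encard_of_infinite (hX : IsSuborderable X)
    (hρ : IsConvexMetric X) (hε : 0 < ε) (N : ℕ) {W : Set X} (hW : IsClopen W)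
    (hi : (componentsIn W).Infinite) : ∃ P, IsFinePartition ε W P ∧ (N : ℕ∞) ≤ P.encard := by
  induction N generalizing W with
  | zero =>
    obtain ⟨P, hP⟩ := exists_isFinePartition hX hρ hε hW
    exact ⟨P, hP, by simp⟩
  | succ N ih =>
    obtain ⟨A, B, hA, hB, rfl, hd, hBn, hAi⟩ := exists_isClopen_infinite_split hX hW hi
    obtain ⟨P, hP, hPN⟩ := ih hA hAi
    obtain ⟨Q, hQ⟩ := exists_isFinePartition hX hρ hε hB
    refine ⟨P ∪ Q, hP.union hQ hd, ?_⟩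
    rw [encard_union_eq (hP.disjoint_of_disjoint hQ hd), Nat.cast_add, Nat.cast_one]
    refine add_le_add hPN (one_le_encard_iff_nonempty.2 ?_)
    rw [← hQ.sUnion_eq] at hBn
    obtain ⟨x, s, hs, -⟩ := hBn
    exact ⟨s, hs⟩

theorem exists_isFinePartition_le_encard (hX : IsSuborderable X) (hρ : IsConvexMetric X)
    (hε : 0 < ε) (N : ℕ) {W : Set X} (hW : IsClopen W) (hN : (N : ℕ∞) ≤ (componentsIn W).encard) :
    ∃ P, IsFinePartition ε W P ∧ (N : ℕ∞) ≤ P.encard := by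
  by_cases hf : (componentsIn W).Finite
  · exact ⟨_, isFinePartition_componentsIn hε hW hf, hN⟩
  · exact exists_isFinePartition_le_encard_of_infinite hX hρ hε N hW hf

/-- Handles `n = 0` and `n = 1` together, for use with `n = ℓ(C)` and `n = r(C)`. -/
theorem exists_finite_subset_mul_le_encard {α : Type*} {A : Set α} {n : ℕ} (hn : n ≤ 1)
    (hA : n ≠ 0 → A.Infinite) (k : ℕ) : ∃ F ⊆ A, F.Finite ∧ ((k * n : ℕ) : ℕ∞) ≤ F.encard := by
  by_cases h : n = 0
  · exact ⟨∅, empty_subset A, finite_empty, by simp [h]⟩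
  · obtain ⟨F, hF, hk⟩ := (hA h).exists_subset_card_eq k
    obtain rfl : n = 1 := by omega
    exact ⟨F, hF, F.finite_toSet, by simp [hk]⟩

theorem IsSuborderable.ell_eq_zero_of_isOpen {K : Set X} (hX : IsSuborderable X) (hK : IsOpen K) :
    ell K = 0 := by
  rw [hX.ell_eq_zero_iff, Set.eq_empty_iff_forall_notMem]
  rintro x ⟨hx, hxK⟩
  obtain ⟨y, hyK, hy⟩ := mem_closure_iff.1 hx K hK hxK
  exact disjoint_left.1 disjoint_openLeft hy hyK

theorem IsSuborderable.arr_eq_zero_of_isOpen {K : Set X} (hX : IsSuborderable X) (hK : IsOpen K) :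
    arr K = 0 := by
  rw [arr_eq_ell_dual]
  exact hX.dual.ell_eq_zero_of_isOpen hK

/-- A partition around a component `C` with `U ⊆ Δ(C, η)`. -/
theorem exists_isFinePartition_around (hX : IsSuborderable X) (hρ : IsConvexMetric X) (hε : 0 < ε)
    {η : ℝ} (hη : 0 < η) {U C : Set X} (hU : IsClopen U) (hUC : U ∉ components X)
    (hC : C ∈ componentsIn U) (hCU : U ⊆ Delta C η) :
    ∃ P, IsFinePartition ε U P ∧ P.encard ≠ 2 ∧
      (∀ s ∈ P, ¬ C ⊆ s → Metric.ediam s ≤ ENNReal.ofReal (η / 2) ∧ (SetLT s C ∨ SetLT C s)) ∧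
      ((6 * ell C : ℕ) : ℕ∞) ≤ {s | s ∈ P ∧ SetLT s C}.encard ∧
      ((6 * arr C : ℕ) : ℕ∞) ≤ {s | s ∈ P ∧ SetLT C s}.encard := by
  have hCsU := subset_of_mem_componentsIn hU hC
  obtain ⟨F, hF, hFf, hFc⟩ := exists_finite_subset_mul_le_encard hX.ell_le_one
    (fun h => hX.infinite_componentsIn_inter_openLeft hC.1 h hU.isOpen hCsU) 6
  obtain ⟨F', hF', hFf', hFc'⟩ := exists_finite_subset_mul_le_encard hX.arr_le_one
    (fun h => hX.infinite_componentsIn_inter_openRight hC.1 h hU.isOpen hCsU) 6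
  have hcl := isClosed_sUnion_components (hFf.union hFf')
    (union_subset (fun K hK => (hF hK).1) fun K hK => (hF' hK).1)
  have hdis : C ⊆ U \ ⋃₀ (F ∪ F') := by
    refine fun x hx => ⟨hCsU hx, ?_⟩
    rintro ⟨K, hK | hK, hxK⟩
    · obtain ⟨y, hy, -, hy'⟩ := (hF hK).2
      rw [eq_of_mem_components (hF hK).1 hC.1 hxK hx] at hy
      exact disjoint_left.1 disjoint_openLeft hy' hy
    · obtain ⟨y, hy, -, hy'⟩ := (hF' hK).2
      rw [eq_of_mem_components (hF' hK).1 hC.1 hxK hx] at hy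
      exact disjoint_left.1 disjoint_openRight hy' hy
  -- `G` encloses `C` but avoids the reserved components, which remain available on the two sides of
  -- `C`.
  obtain ⟨G, hG, hCG, hGU⟩ :=
    exists_mem_clopenFamilyWithin hX hε hC.1 (hU.isOpen.sdiff hcl) hdis
  have hd : Disjoint (U \ G) C := Set.disjoint_left.2 fun x hx hxC => hx.2 (hCG hxC)
  have hWc : IsClopen (U \ G) := hU.diff hG.1.1
  have hsub : F ⊆ componentsIn ((U \ G) ∩ openLeft C) := fun K hK => by
    obtain ⟨y, hy, hyU, hy'⟩ := (hF hK).2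
    exact ⟨(hF hK).1, y, hy, ⟨hyU, fun hyG => (hGU hyG).2 ⟨K, Or.inl hK, hy⟩⟩, hy'⟩
  have hsub' : F' ⊆ componentsIn ((U \ G) ∩ openRight C) := fun K hK => by
    obtain ⟨y, hy, hyU, hy'⟩ := (hF' hK).2
    exact ⟨(hF' hK).1, y, hy, ⟨hyU, fun hyG => (hGU hyG).2 ⟨K, Or.inr hK, hy⟩⟩, hy'⟩
  obtain ⟨P, hP, hPc⟩ := exists_isFinePartition_le_encard hX hρ hε _
    (hX.isClopen_inter_openLeft hC.1 hWc hd) (hFc.trans (encard_le_encard hsub))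
  obtain ⟨Q, hQ, hQc⟩ := exists_isFinePartition_le_encard hX hρ hε _
    (hX.isClopen_inter_openRight hC.1 hWc hd) (hFc'.trans (encard_le_encard hsub'))
  have hPl : ∀ s ∈ P, SetLT s C := fun s hs x hx => (hP.subset_of_mem hs hx).2
  have hQr : ∀ s ∈ Q, SetLT C s := fun s hs x hx y hy => (hQ.subset_of_mem hs hy).2 x hx
  have hUo : U ⊆ openNhd C (η / 2) := hCU.trans (Delta_subset_openNhd hη)
  have hPcard := hPc.trans (encard_le_encard (s := P) (t := {s | s ∈ {G} ∪ (P ∪ Q) ∧ SetLT s C})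
    fun s hs => ⟨Or.inr (Or.inl hs), hPl s hs⟩)
  have hQcard := hQc.trans (encard_le_encard (s := Q) (t := {s | s ∈ {G} ∪ (P ∪ Q) ∧ SetLT C s})
    fun s hs => ⟨Or.inr (Or.inr hs), hQr s hs⟩)
  refine ⟨{G} ∪ (P ∪ Q), ?_, ?_, ?_, hPcard, hQcard⟩
  · have hu : U = G ∪ ((U \ G) ∩ openLeft C ∪ (U \ G) ∩ openRight C) := by
      rw [← inter_union_distrib_left, inter_eq_left.2, union_sdiff_cancel (hGU.trans sdiff_subset)]
      exact fun x hx => hX.mem_openLeft_or_mem_openRight hC.1 (disjoint_left.1 hd hx)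
    rw [hu]
    refine (isFinePartition_singleton hG).union (hP.union hQ ?_) ?_
    · exact (disjoint_openLeft_openRight hC.1).mono inter_subset_right inter_subset_right
    · rw [← inter_union_distrib_left]
      exact disjoint_sdiff_right.mono_right inter_subset_left
  -- If both vanished, `Δ(C, η) = C` would make `U` a component. Thus some side has at least six
  -- pieces, which excludes a total of two.
  · have h6 : ell C ≠ 0 ∨ arr C ≠ 0 := by
      by_contra! h
      refine hUC ?_
      rw [Delta, if_pos h] at hCU
      rw [hCU.antisymm hCsU]
      exact hC.1
    intro h2
    have key : ∀ n : ℕ, n ≠ 0 → ((6 * n : ℕ) : ℕ∞) ≤ ({G} ∪ (P ∪ Q) : Set (Set X)).encard →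
        False := by
      intro n hn h
      rw [h2] at h
      have : 6 * n ≤ 2 := by exact_mod_cast h
      omega
    rcases h6 with h | h
    · exact key _ h (hPcard.trans (encard_le_encard fun s hs => hs.1))
    · exact key _ h (hQcard.trans (encard_le_encard fun s hs => hs.1))
  · rintro s (rfl | hs | hs) hCs
    · exact absurd hCG hCs
    · have hsC : s ⊆ openNhd C (η / 2) ∩ openLeft C := fun x hx =>
        ⟨hUo (hP.subset_of_mem hs hx).1.1, (hP.subset_of_mem hs hx).2⟩
      exact ⟨(Metric.ediam_mono hsC).trans (hρ.ediam_openNhd_inter_openLeft_le C _),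
        Or.inl (hPl s hs)⟩
    · have hsC : s ⊆ openNhd C (η / 2) ∩ openRight C := fun x hx =>
        ⟨hUo (hQ.subset_of_mem hs hx).1.1, (hQ.subset_of_mem hs hx).2⟩
      exact ⟨(Metric.ediam_mono hsC).trans (hρ.ediam_openNhd_inter_openRight_le C _),
        Or.inr (hQr s hs)⟩

/-- The node of a member `U` of `𝒟[X, η]`: a partition into members of `𝒟[X, ε]` which surrounds
every component of `U` of diameter at least `η`. -/
structure IsSplitting (ε η : ℝ) (U : Set X) (P : Set (Set X)) : Prop where
  isFinePartition : IsFinePartition ε U P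
  encard_ne_two : P.encard ≠ 2
  small : ∀ C ∈ largeComponents η U, ∀ s ∈ P, ¬ C ⊆ s →
    Metric.ediam s ≤ ENNReal.ofReal (η / 2) ∧ (SetLT s C ∨ SetLT C s)
  left : ∀ C ∈ largeComponents η U, ((6 * ell C : ℕ) : ℕ∞) ≤ {s | s ∈ P ∧ SetLT s C}.encard
  right : ∀ C ∈ largeComponents η U, ((6 * arr C : ℕ) : ℕ∞) ≤ {s | s ∈ P ∧ SetLT C s}.encard

theorem exists_isFinePartition_encard_ne_two (hX : IsSuborderable X) (hρ : IsConvexMetric X)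
    (hε : 0 < ε) {U : Set X} (hU : IsClopen U) (hi : (componentsIn U).Infinite) :
    ∃ P, IsFinePartition ε U P ∧ P.encard ≠ 2 := by
  obtain ⟨P, hP, h3⟩ := exists_isFinePartition_le_encard_of_infinite hX hρ hε 3 hU hi
  refine ⟨P, hP, fun h => ?_⟩
  rw [h] at h3
  have : 3 ≤ 2 := by exact_mod_cast h3
  omega

theorem exists_isSplitting (hX : IsSuborderable X) (hρ : IsConvexMetric X) (hε : 0 < ε)
    {η : ℝ} (hη : 0 < η) {U : Set X} (hU : U ∈ clopenFamilyWithin X η) :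
    ∃ P, IsSplitting ε η U P := by
  by_cases hUC : U ∈ components X
  · have hC : ∀ C ∈ largeComponents η U, C = U := fun C hC =>
      eq_of_mem_components hC.1.1 hUC hC.1.2.some_mem.1 hC.1.2.some_mem.2
    refine ⟨{U}, isFinePartition_singleton
      (mem_clopenFamilyWithin_of_mem_components hε hUC hU.1.1), by simp, ?_, ?_, ?_⟩
    · rintro C hC' s rfl hCs
      exact absurd (hC C hC').subset hCs
    · intro C hC'
      rw [hC C hC', hX.ell_eq_zero_of_isOpen hU.1.1.isOpen]
      simp
    · intro C hC'
      rw [hC C hC', hX.arr_eq_zero_of_isOpen hU.1.1.isOpen]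
      simp
  obtain ⟨⟨hUc, hUi⟩, hlt | ⟨C, hC, hCU⟩⟩ := hU
  · obtain ⟨P, hP, h2⟩ := exists_isFinePartition_encard_ne_two hX hρ hε hUc
      (hUi.resolve_left hUC)
    have hno : ∀ C, C ∉ largeComponents η U := fun C hC => absurd hlt
      (not_lt.2 (hC.2.trans (Metric.ediam_mono (subset_of_mem_componentsIn hUc hC.1))))
    exact ⟨P, hP, h2, fun C hC => absurd hC (hno C), fun C hC => absurd hC (hno C),
      fun C hC => absurd hC (hno C)⟩
  -- All other components of `U` have diameter at most `η / 2`.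
  · have huniq : ∀ C' ∈ largeComponents η U, C' = C := by
      intro C' hC'
      by_contra hne
      have := hC'.2.trans (hρ.ediam_le_of_subset_openNhd hX hC.1.1 hC'.1.1 hne
        ((subset_of_mem_componentsIn hUc hC'.1).trans (hCU.trans (Delta_subset_openNhd hη))))
      rw [ENNReal.ofReal_le_ofReal_iff (by linarith)] at this
      linarith
    obtain ⟨P, hP, h2, h, hl, hr⟩ := exists_isFinePartition_around hX hρ hε hη hUc hUC hC.1 hCU
    refine ⟨P, hP, h2, ?_, ?_, ?_⟩ <;> intro C' hC' <;> obtain rfl := huniq C' hC' <;> assumption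

end Splitting

/-! ### The tree of a refining sequence of partitions -/

section SequenceTree

variable {X : Type u}

/-- A sequence of partitions of `X`, each of which refines its predecessors. -/
structure IsRefiningSequence (Lev : ℕ → Set (Set X)) : Prop where
  nonempty : ∀ n, ∀ U ∈ Lev n, U.Nonempty
  disjoint : ∀ n, (Lev n).PairwiseDisjoint id
  sUnion_eq : ∀ n, ⋃₀ Lev n = univ
  refine : ∀ n, ∀ V ∈ Lev (n + 1), ∃ U ∈ Lev n, V ⊆ U

/-- The tree of all members of a sequence of partitions. -/
def SequenceTree (Lev : ℕ → Set (Set X)) : Type u := {p : ℕ × Set X // p.2 ∈ Lev p.1}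

namespace SequenceTree

variable {Lev : ℕ → Set (Set X)}

/-- The level of an element of the tree. -/
def level (t : SequenceTree Lev) : ℕ := t.1.1

/-- The set at an element of the tree. -/
def carrier (t : SequenceTree Lev) : Set X := t.1.2

theorem carrier_mem (t : SequenceTree Lev) : t.carrier ∈ Lev t.level := t.2

theorem ext {s t : SequenceTree Lev} (h : s.level = t.level) (h' : s.carrier = t.carrier) :
    s = t := Subtype.ext (Prod.ext h h')

/-- Levels are compared too, since the same set may occur on several levels. -/
instance : PartialOrder (SequenceTree Lev) where
  le s t := s.level ≤ t.level ∧ t.carrier ⊆ s.carrier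
  le_refl _ := ⟨le_rfl, subset_rfl⟩
  le_trans _ _ _ h h' := ⟨h.1.trans h'.1, h'.2.trans h.2⟩
  le_antisymm _ _ h h' := ext (le_antisymm h.1 h'.1) (Subset.antisymm h'.2 h.2)

end SequenceTree

namespace IsRefiningSequence

open SequenceTree

variable {Lev : ℕ → Set (Set X)} (h : IsRefiningSequence Lev)
include h

theorem exists_superset {m n : ℕ} (hmn : m ≤ n) {V : Set X} (hV : V ∈ Lev n) :
    ∃ U ∈ Lev m, V ⊆ U := by
  induction n, hmn using Nat.le_induction generalizing V with
  | base => exact ⟨V, hV, subset_rfl⟩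
  | succ n _ ih =>
    obtain ⟨U, hU, hVU⟩ := h.refine n V hV
    obtain ⟨U', hU', hUU'⟩ := ih hU
    exact ⟨U', hU', hVU.trans hUU'⟩

theorem eq_of_mem {n : ℕ} {U V : Set X} (hU : U ∈ Lev n) (hV : V ∈ Lev n) {x : X}
    (hxU : x ∈ U) (hxV : x ∈ V) : U = V := by
  by_contra hne
  exact disjoint_left.1 (h.disjoint n hU hV hne) hxU hxV

theorem exists_mem (n : ℕ) (x : X) : ∃ t : SequenceTree Lev, t.level = n ∧ x ∈ t.carrier := by
  obtain ⟨U, hU, hx⟩ : x ∈ ⋃₀ Lev n := h.sUnion_eq n ▸ mem_univ x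
  exact ⟨⟨(n, U), hU⟩, rfl, hx⟩

theorem le_of_mem {s t : SequenceTree Lev} (hl : s.level ≤ t.level) {x : X}
    (hs : x ∈ s.carrier) (ht : x ∈ t.carrier) : s ≤ t := by
  obtain ⟨U, hU, htU⟩ := h.exists_superset hl t.carrier_mem
  rw [h.eq_of_mem hU s.carrier_mem (htU ht) hs] at htU
  exact ⟨hl, htU⟩

theorem le_or_le_of_mem {s t : SequenceTree Lev} {x : X} (hs : x ∈ s.carrier)
    (ht : x ∈ t.carrier) : s ≤ t ∨ t ≤ s :=
  (le_total s.level t.level).imp (fun hl => h.le_of_mem hl hs ht) fun hl => h.le_of_mem hl ht hs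

theorem nonempty_carrier (t : SequenceTree Lev) : t.carrier.Nonempty :=
  h.nonempty _ _ t.carrier_mem

theorem eq_of_le_of_level_eq {s t : SequenceTree Lev} (hst : s ≤ t) (hl : s.level = t.level) :
    s = t := by
  obtain ⟨x, hx⟩ := h.nonempty_carrier t
  exact le_antisymm hst (h.le_of_mem hl.ge hx (hst.2 hx))

theorem level_lt_of_lt {s t : SequenceTree Lev} (hst : s < t) : s.level < t.level :=
  lt_of_le_of_ne hst.le.1 fun hl => hst.ne (h.eq_of_le_of_level_eq hst.le hl)

theorem covBy_iff {s t : SequenceTree Lev} :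
    s ⋖ t ↔ t.level = s.level + 1 ∧ t.carrier ⊆ s.carrier := by
  obtain ⟨x, hx⟩ := h.nonempty_carrier t
  constructor
  · intro hst
    refine ⟨?_, hst.lt.le.2⟩
    by_contra hne
    have hlt := h.level_lt_of_lt hst.lt
    obtain ⟨r, hr, hxr⟩ := h.exists_mem (s.level + 1) x
    refine hst.2 (c := r) ?_ ?_
    · refine lt_of_le_of_ne (h.le_of_mem (by omega) (hst.lt.le.2 hx) hxr) fun he => ?_
      rw [← he] at hr
      omega
    · refine lt_of_le_of_ne (h.le_of_mem (by omega) hxr hx) fun he => ?_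
      rw [he] at hr
      exact hne hr
  · rintro ⟨hl, hc⟩
    refine ⟨lt_of_le_of_ne ⟨by omega, hc⟩ fun he => ?_, fun r hsr hrt => ?_⟩
    · rw [he] at hl
      omega
    · have := h.level_lt_of_lt hsr
      have := h.level_lt_of_lt hrt
      omega

theorem isTree : IsTree (SequenceTree Lev) := by
  intro t
  obtain ⟨x, hx⟩ := h.nonempty_carrier t
  have hwf : WellFounded ((· < ·) : {s // s ≤ t} → {s // s ≤ t} → Prop) :=
    Subrelation.wf (r := InvImage (· < ·) fun s : {s // s ≤ t} => s.1.level)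
      (fun {a b} hab => h.level_lt_of_lt (s := a.1) (t := b.1) hab) (InvImage.wf _ Nat.lt_wfRel.wf)
  have htri : ∀ a b : {s // s ≤ t}, ¬ a < b → ¬ b < a → a = b := by
    intro a b hab hba
    rcases h.le_or_le_of_mem (a.2.2 hx) (b.2.2 hx) with hl | hl
    · exact (hl.lt_or_eq.resolve_left hab |> Subtype.ext)
    · exact (hl.lt_or_eq.resolve_left hba |> Subtype.ext).symm
  exact { trichotomous := htri, wf := hwf }

/-- By strong induction, the elements outside the earlier levels are those of index at least `n`.
Each of them lies above one of index exactly `n`, so only the latter are minimal. -/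
theorem treeLevel_natCast (n : ℕ) :
    treeLevel (SequenceTree Lev) n = {t | t.level = n} := by
  induction n using Nat.strong_induction_on with
  | _ n ih =>
    have key : ∀ s : SequenceTree Lev,
        (∀ β : Ordinal.{u}, β < n → s ∉ treeLevel (SequenceTree Lev) β) ↔ n ≤ s.level := by
      intro s
      constructor
      · intro hs
        by_contra! hlt
        refine hs s.level (by exact_mod_cast hlt) ?_
        rw [ih _ hlt]
        rfl
      · intro hs β hβ hsβ
        obtain ⟨m, rfl⟩ := Ordinal.lt_omega0.1 (hβ.trans (Ordinal.natCast_lt_omega0 n))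
        have hm : m < n := by exact_mod_cast hβ
        rw [ih m hm] at hsβ
        exact absurd (show s.level = m from hsβ) (by omega)
    rw [treeLevel]
    ext t
    simp only [key]
    constructor
    · intro ht
      by_contra hne
      have hlt : n < t.level := lt_of_le_of_ne ht.1 (Ne.symm hne)
      obtain ⟨x, hx⟩ := h.nonempty_carrier t
      obtain ⟨s, hs, hxs⟩ := h.exists_mem n x
      have := (ht.2 hs.ge (h.le_of_mem (hs.trans_le hlt.le) hxs hx)).1
      omega
    · rintro (rfl : t.level = n)
      exact ⟨le_rfl, fun s hs hst => (h.eq_of_le_of_level_eq hst (le_antisymm hst.1 hs)).ge⟩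

theorem treeHeight_eq [Nonempty X] : treeHeight (SequenceTree Lev) = Ordinal.omega0 := by
  obtain ⟨x⟩ := ‹Nonempty X›
  refine le_antisymm (csInf_le' fun t => ⟨t.level, Ordinal.natCast_lt_omega0 _, ?_⟩)
    (le_csInf ⟨Ordinal.omega0, fun t => ⟨t.level, Ordinal.natCast_lt_omega0 _, ?_⟩⟩ ?_)
  · rw [h.treeLevel_natCast]
    rfl
  · rw [h.treeLevel_natCast]
    rfl
  · intro α hα
    by_contra! hlt
    obtain ⟨n, rfl⟩ := Ordinal.lt_omega0.1 hlt
    obtain ⟨t, ht, -⟩ := h.exists_mem n x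
    obtain ⟨β, hβ, htβ⟩ := hα t
    obtain ⟨m, rfl⟩ := Ordinal.lt_omega0.1 (hβ.trans hlt)
    rw [h.treeLevel_natCast] at htβ
    have hm : m < n := by exact_mod_cast hβ
    exact absurd (show t.level = m from htβ) (by omega)

theorem exists_mem_node (t : SequenceTree Lev) {x : X} (hx : x ∈ t.carrier) :
    ∃ s ∈ node t, x ∈ s.carrier := by
  obtain ⟨s, hs, hxs⟩ := h.exists_mem (t.level + 1) x
  exact ⟨s, h.covBy_iff.2 ⟨hs, (h.le_of_mem (by omega) hx hxs).2⟩, hxs⟩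

theorem isPruned : IsPruned (SequenceTree Lev) := fun t => by
  obtain ⟨x, hx⟩ := h.nonempty_carrier t
  obtain ⟨s, hs, -⟩ := h.exists_mem_node t hx
  exact ⟨s, hs⟩

theorem isSieve : IsSieve (carrier : SequenceTree Lev → Set X) := by
  refine ⟨h.nonempty_carrier, ?_, fun t => Subset.antisymm (fun x hx => ?_) ?_⟩
  · rw [← Nat.cast_zero, h.treeLevel_natCast, eq_univ_iff_forall]
    intro x
    obtain ⟨t, ht, hx⟩ := h.exists_mem 0 x
    exact mem_biUnion ht hx
  · obtain ⟨s, hs, hxs⟩ := h.exists_mem_node t hx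
    exact mem_biUnion hs hxs
  · exact iUnion₂_subset fun s hs => (h.covBy_iff.1 hs).2

theorem isDiscreteSieve [TopologicalSpace X] (ho : ∀ n, ∀ U ∈ Lev n, IsOpen U) :
    IsDiscreteSieve (carrier : SequenceTree Lev → Set X) := by
  refine ⟨h.isSieve, fun n => ⟨fun x => ?_, ?_⟩⟩
  · obtain ⟨t, rfl, hx⟩ := h.exists_mem n x
    refine ⟨t.carrier, (ho _ _ t.carrier_mem).mem_nhds hx, ?_⟩
    have key : ∀ s : SequenceTree Lev, s ∈ treeLevel (SequenceTree Lev) t.level →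
        (s.carrier ∩ t.carrier).Nonempty → s = t := by
      rintro s hs ⟨y, hys, hyt⟩
      rw [h.treeLevel_natCast] at hs
      exact h.eq_of_le_of_level_eq (h.le_of_mem (le_of_eq hs) hys hyt) hs
    rintro s ⟨hs, hs'⟩ r ⟨hr, hr'⟩
    rw [key s hs hs', key r hr hr']
  · rw [eq_univ_iff_forall, h.treeLevel_natCast]
    intro x
    obtain ⟨t, ht, hx⟩ := h.exists_mem n x
    exact mem_biUnion ht hx

omit h in
theorem injOn_carrier (n : ℕ) : InjOn (carrier : SequenceTree Lev → Set X) {t | t.level = n} :=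
  fun _ hs _ ht he => ext (hs.trans ht.symm) he

theorem encard_treeLevel_zero : (treeLevel (SequenceTree Lev) 0).encard = (Lev 0).encard := by
  rw [← Nat.cast_zero, h.treeLevel_natCast, ← (injOn_carrier 0).encard_image]
  congr 1
  ext U
  constructor
  · rintro ⟨t, ht, rfl⟩
    exact (show t.level = 0 from ht) ▸ t.carrier_mem
  · exact fun hU => ⟨⟨(0, U), hU⟩, rfl, rfl⟩

/-- The number of immediate successors with a given property of the underlying sets. -/
theorem encard_node (t : SequenceTree Lev) (p : Set X → Prop) :
    {s | s ∈ node t ∧ p s.carrier}.encard =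
      {V | (V ∈ Lev (t.level + 1) ∧ V ⊆ t.carrier) ∧ p V}.encard := by
  have hsub : {s | s ∈ node t ∧ p s.carrier} ⊆ {s | s.level = t.level + 1} :=
    fun s hs => (h.covBy_iff.1 hs.1).1
  rw [← ((injOn_carrier _).mono hsub).encard_image]
  congr 1
  ext V
  constructor
  · rintro ⟨s, ⟨hs, hp⟩, rfl⟩
    obtain ⟨hl, hc⟩ := h.covBy_iff.1 hs
    exact ⟨⟨hl ▸ s.carrier_mem, hc⟩, hp⟩
  · rintro ⟨⟨hV, hVt⟩, hp⟩
    exact ⟨⟨(t.level + 1, V), hV⟩, ⟨h.covBy_iff.2 ⟨rfl, hVt⟩, hp⟩, rfl⟩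

/-- A connected set lies along exactly one branch of a tree of clopen partitions. -/
theorem existsUnique_isBranch [TopologicalSpace X] (ho : ∀ n, ∀ U ∈ Lev n, IsClopen U)
    {C : Set X} (hC : IsConnected C) :
    ∃! b : Set (SequenceTree Lev), IsBranch b ∧ C ⊆ ⋂ t ∈ b, t.carrier := by
  obtain ⟨x, hx⟩ := hC.nonempty
  set b : Set (SequenceTree Lev) := {t | C ⊆ t.carrier} with hb
  have hchain : IsChain (· ≤ ·) b := fun s hs t ht _ => h.le_or_le_of_mem (hs hx) (ht hx)
  refine ⟨b, ⟨⟨hchain, fun c hc hbc => Subset.antisymm hbc fun t ht => ?_⟩,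
    subset_iInter₂ fun t ht => ht⟩, ?_⟩
  -- An element `t` of a larger chain is comparable with the member of `b` on its own level, hence
  -- equal to it.
  · obtain ⟨s, hs, hxs⟩ := h.exists_mem t.level x
    have hsb : s ∈ b := hC.isPreconnected.subset_isClopen (ho _ _ s.carrier_mem) ⟨x, hx, hxs⟩
    rcases hc.total ht (hbc hsb) with hl | hl
    · rwa [h.eq_of_le_of_level_eq hl hs.symm]
    · rwa [← h.eq_of_le_of_level_eq hl hs]
  · rintro b' ⟨hb', hCb'⟩
    exact hb'.2 hchain fun t ht => hCb'.trans (biInter_subset_of_mem ht)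

end IsRefiningSequence
end SequenceTree

/-! ### Iterating the splittings -/

section Main

/-- The sequence of partitions which is obtained from `P₀` by replacing all members `U` of the
`n`-th partition by the members of `Q n U`. -/
def iteratedSplitting {X : Type u} (P₀ : Set (Set X)) (Q : ℕ → Set X → Set (Set X)) :
    ℕ → Set (Set X)
  | 0 => P₀
  | n + 1 => ⋃ U : iteratedSplitting P₀ Q n, Q n U

variable {X : Type u}

theorem isFinePartition_iteratedSplitting [MetricSpace X] [LinearOrder X] {δ : ℕ → ℝ}
    {P₀ : Set (Set X)} {Q : ℕ → Set X → Set (Set X)} (h₀ : IsFinePartition (δ 0) univ P₀)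
    (hQ : ∀ n, ∀ U ∈ clopenFamilyWithin X (δ n), IsFinePartition (δ (n + 1)) U (Q n U)) (n : ℕ) :
    IsFinePartition (δ n) univ (iteratedSplitting P₀ Q n) := by
  induction n with
  | zero => exact h₀
  | succ n ih =>
    rw [← ih.sUnion_eq, sUnion_eq_iUnion]
    refine IsFinePartition.iUnion (fun U => hQ n U (ih.subset U.2)) fun U V hne => ?_
    exact ih.disjoint U.2 V.2 fun h => hne (Subtype.ext h)

theorem isRefiningSequence_iteratedSplitting [MetricSpace X] [LinearOrder X] {δ : ℕ → ℝ}
    {P₀ : Set (Set X)} {Q : ℕ → Set X → Set (Set X)} (h₀ : IsFinePartition (δ 0) univ P₀)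
    (hQ : ∀ n, ∀ U ∈ clopenFamilyWithin X (δ n), IsFinePartition (δ (n + 1)) U (Q n U)) :
    IsRefiningSequence (iteratedSplitting P₀ Q) where
  nonempty n _ hU := (isFinePartition_iteratedSplitting h₀ hQ n).nonempty_of_mem hU
  disjoint n := (isFinePartition_iteratedSplitting h₀ hQ n).disjoint
  sUnion_eq n := (isFinePartition_iteratedSplitting h₀ hQ n).sUnion_eq
  refine n V hV := by
    obtain ⟨U, hVU⟩ := mem_iUnion.1 hV
    exact ⟨U, U.2, (hQ n U ((isFinePartition_iteratedSplitting h₀ hQ n).subset U.2)).subset_of_mem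
      hVU⟩

theorem mem_iteratedSplitting_succ_and_subset_iff [MetricSpace X] [LinearOrder X] {δ : ℕ → ℝ}
    {P₀ : Set (Set X)} {Q : ℕ → Set X → Set (Set X)} (h₀ : IsFinePartition (δ 0) univ P₀)
    (hQ : ∀ n, ∀ U ∈ clopenFamilyWithin X (δ n), IsFinePartition (δ (n + 1)) U (Q n U)) {n : ℕ}
    {U V : Set X} (hU : U ∈ iteratedSplitting P₀ Q n) :
    V ∈ iteratedSplitting P₀ Q (n + 1) ∧ V ⊆ U ↔ V ∈ Q n U := by
  have hP := isFinePartition_iteratedSplitting h₀ hQ n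
  constructor
  · rintro ⟨hV, hVU⟩
    obtain ⟨U', hVU'⟩ := mem_iUnion.1 hV
    have hQ' := hQ n U' (hP.subset U'.2)
    obtain ⟨x, hx⟩ := hQ'.nonempty_of_mem hVU'
    have : U = U' := (isRefiningSequence_iteratedSplitting h₀ hQ).eq_of_mem hU U'.2 (hVU hx)
      (hQ'.subset_of_mem hVU' hx)
    rwa [this]
  · exact fun hV => ⟨mem_iUnion.2 ⟨⟨U, hU⟩, hV⟩, (hQ n U (hP.subset hU)).subset_of_mem hV⟩

theorem ofReal_two_zpow_le_ediam_of_kappa_le [MetricSpace X] {C : Set X}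
    (hC : C ∈ nondegenerateComponents (univ : Set X)) {n : ℕ} (hn : kappa C ≤ n) :
    ENNReal.ofReal ((2 : ℝ) ^ (-(n : ℤ))) ≤ Metric.ediam C := by
  simp only [nondegenerateComponents, mem_iUnion] at hC
  obtain ⟨ε, hε, -, hC⟩ := hC
  obtain ⟨m, hm⟩ := exists_pow_lt_of_lt_one hε (by norm_num : (1 / 2 : ℝ) < 1)
  have hne : {n : ℕ | ENNReal.ofReal ((2 : ℝ) ^ (-(n : ℤ))) ≤ Metric.ediam C}.Nonempty := by
    refine ⟨m, (ENNReal.ofReal_le_ofReal ?_).trans hC⟩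
    rw [zpow_neg, zpow_natCast, ← inv_pow, ← one_div]
    exact hm.le
  -- Nonemptiness matters: only then is the infimum `κ[C]` attained rather than the default value
  -- `0`.
  refine le_trans (ENNReal.ofReal_le_ofReal ?_) (Nat.sInf_mem hne)
  exact zpow_le_zpow_right₀ one_le_two (by simpa [kappa] using hn)

end Main
end SuborderSieve

theorem theorem4p7 {X : Type u} [MetricSpace X] [LinearOrder X]
    (hX : IsSuborderable X) (hρ : IsConvexMetric X) (hinf : (components X).Infinite) :
    ∃ (T : Type u) (_ : PartialOrder T) (S : T → Set X),
      IsTree T ∧ treeHeight T = Ordinal.omega0 ∧ IsPruned T ∧ IsAntiBinary T ∧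
      IsDiscreteSieve S ∧
      (∀ t : T, S t ∈ clopenFamily X) ∧
      (∀ n : ℕ, ∀ t ∈ treeLevel T n, S t ∈ clopenFamilyWithin X ((2 : ℝ) ^ (-(n : ℤ)))) ∧
      ∀ C ∈ nondegenerateComponents (univ : Set X),
        (∃! b : Set T, IsBranch b ∧ C ⊆ ⋂ t ∈ b, S t) ∧
        ∀ b : Set T, IsBranch b → C ⊆ ⋂ t ∈ b, S t →
          ∀ n : ℕ, kappa C ≤ n → ∀ t ∈ b ∩ treeLevel T n, ∀ p ∈ b ∩ node t,
            (∀ s ∈ node t, s ≠ p →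
              Metric.ediam (S s) ≤ ENNReal.ofReal ((2 : ℝ) ^ (-(n : ℤ) + 1)) ∧
              (SetLT (S s) C ∨ SetLT C (S s))) ∧
            ((6 * ell C : ℕ) : ℕ∞) ≤ {s | s ∈ node t ∧ SetLT (S s) C}.encard ∧
            ((6 * arr C : ℕ) : ℕ∞) ≤ {s | s ∈ node t ∧ SetLT C (S s)}.encard := by
  set δ : ℕ → ℝ := fun n => (2 : ℝ) ^ (-(n : ℤ)) with hδ
  have hδ0 : ∀ n, 0 < δ n := fun n => by positivity
  obtain ⟨P₀, h₀, h₀2⟩ := exists_isFinePartition_encard_ne_two hX hρ (hδ0 0) isClopen_univ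
    (hinf.mono fun C hC => mem_componentsIn_of_subset hC (subset_univ C))
  have hQ : ∀ n (U : Set X), ∃ P, U ∈ clopenFamilyWithin X (δ n) →
      IsSplitting (δ (n + 1)) (δ n) U P := by
    intro n U
    by_cases hU : U ∈ clopenFamilyWithin X (δ n)
    · obtain ⟨P, hP⟩ := exists_isSplitting hX hρ (hδ0 (n + 1)) (hδ0 n) hU
      exact ⟨P, fun _ => hP⟩
    -- A default value outside 𝒟[X, 2⁻ⁿ], so that `Q` is defined on all sets.
    · exact ⟨∅, fun h => absurd h hU⟩
  choose Q hQ using hQ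
  have hQ' : ∀ n, ∀ U ∈ clopenFamilyWithin X (δ n), IsFinePartition (δ (n + 1)) U (Q n U) :=
    fun n U hU => (hQ n U hU).isFinePartition
  have hP := isFinePartition_iteratedSplitting h₀ hQ'
  have h := isRefiningSequence_iteratedSplitting h₀ hQ'
  have hclopen : ∀ n, ∀ U ∈ iteratedSplitting P₀ Q n, IsClopen U :=
    fun n U hU => ((hP n).subset hU).1.1
  have hnode : ∀ (t : SequenceTree (iteratedSplitting P₀ Q)) (p : Set X → Prop),
      {s | s ∈ node t ∧ p s.carrier}.encard = {V | V ∈ Q t.level t.carrier ∧ p V}.encard := by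
    intro t p
    rw [h.encard_node]
    simp only [mem_iteratedSplitting_succ_and_subset_iff h₀ hQ' t.carrier_mem]
  have : Nonempty X := by
    obtain ⟨_, x, -⟩ := hinf.nonempty
    exact ⟨x⟩
  refine ⟨SequenceTree (iteratedSplitting P₀ Q), inferInstance, SequenceTree.carrier, h.isTree,
    h.treeHeight_eq, h.isPruned, ⟨?_, fun t => ?_⟩,
    h.isDiscreteSieve fun n U hU => (hclopen n U hU).isOpen,
    fun t => ((hP _).subset t.carrier_mem).1, fun n t ht => ?_, fun C hC => ⟨?_, ?_⟩⟩
  · rw [h.encard_treeLevel_zero]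
    exact h₀2
  · have := hnode t fun _ => True
    simp only [and_true] at this
    exact this.trans_ne (hQ _ _ ((hP _).subset t.carrier_mem)).encard_ne_two
  · rw [h.treeLevel_natCast] at ht
    obtain rfl : t.level = n := ht
    exact (hP _).subset t.carrier_mem
  · simp only [nondegenerateComponents, mem_iUnion] at hC
    obtain ⟨ε, hε, hC⟩ := hC
    exact h.existsUnique_isBranch hclopen (isConnected_of_mem_components hC.1.1)
  · rintro b - hCb n hn t ⟨htb, ht⟩ p ⟨hpb, hpt⟩
    have hCn := ofReal_two_zpow_le_ediam_of_kappa_le hC hn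
    have hCc : C ∈ components X := by
      simp only [nondegenerateComponents, mem_iUnion] at hC
      obtain ⟨ε, hε, hC⟩ := hC
      exact hC.1.1
    rw [h.treeLevel_natCast] at ht
    obtain rfl : t.level = n := ht
    have hsp := hQ _ _ ((hP _).subset t.carrier_mem)
    have hCl : C ∈ largeComponents (δ t.level) t.carrier :=
      ⟨mem_componentsIn_of_subset hCc (hCb.trans (biInter_subset_of_mem htb)), hCn⟩
    refine ⟨fun s hs hsne => ?_, ?_, ?_⟩
    · have hCp : C ⊆ p.carrier := hCb.trans (biInter_subset_of_mem hpb)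
      obtain ⟨hsl, hsc⟩ := h.covBy_iff.1 hs
      -- Elements of one level whose sets both contain `C` coincide, and `p` is already such an
      -- element.
      have hCs : ¬ C ⊆ s.carrier := by
        intro hCs
        obtain ⟨x, hx⟩ := (isConnected_of_mem_components hCc).nonempty
        have hl : s.level = p.level := hsl.trans (h.covBy_iff.1 hpt).1.symm
        exact hsne (h.eq_of_le_of_level_eq (h.le_of_mem hl.le (hCs hx) (hCp hx)) hl)
      obtain ⟨hd, hlt⟩ := hsp.small C hCl s.carrier
        ((mem_iteratedSplitting_succ_and_subset_iff h₀ hQ' t.carrier_mem).1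
          ⟨hsl ▸ s.carrier_mem, hsc⟩) hCs
      refine ⟨hd.trans (ENNReal.ofReal_le_ofReal ?_), hlt⟩
      -- The splitting gives `2⁻ⁿ / 2`, stronger than the required `2⁻ⁿ⁺¹`.
      rw [zpow_add_one₀ two_ne_zero]
      linarith [hδ0 t.level]
    · rw [hnode t fun V => SetLT V C]
      exact hsp.left C hCl
    · rw [hnode t fun V => SetLT C V]
      exact hsp.right C hCl
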